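/- Let $N\ge 1$, let $\Lambda=(\mathbb Z/N)^4$ be the four-dimensional periodic hypercubic lattice, and let $d$, $\partial$ denote the exterior derivative and boundary operators on lattice forms, $(d\alpha)_{x,\mu_1\cdots\mu_{r+1}}=\sum_j(-1)^{j+1}[\alpha_{x+\hat\mu_j,\mu_1\cdots\mathring\mu_j\cdots\mu_{r+1}}-\alpha_{x,\mu_1\cdots\mathring\mu_j\cdots\mu_{r+1}}]$ and $(\partial\alpha)_{x,\mu_1\cdots\mu_{r-1}}=\sum_\nu[\alpha_{x,\mu_1\cdots\mu_{r-1}\nu}-\alpha_{x-\hat\nu,\mu_1\cdots\mu_{r-1}\nu}]$. Write $F\cdot G=\sum_x\sum_{\mu<\nu}F_{x,\mu\nu}G_{x,\mu\nu}$ for 2-forms, let $\epsilon$ be the matrix $\epsilon_{x,\mu\nu|y,\rho\sigma}=\epsilon_{\mu\nu\rho\sigma}\,\delta_{x+\hat\mu+\hat\nu,y}$, and set $Q_0[F]=\frac1{8\pi^2}F\cdot\epsilon F$. For $\beta>0$ and $\theta\in\mathbb R$ let $$Z[\beta,\theta]=\int_{[-\pi,\pi)^{4N^4}}\prod_{x,\mu}\frac{dA^e_{x,\mu}}{2\pi}\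 \sum_{n:\,dn=0}\exp\Big(-\frac\beta2F^e\cdot F^e-i\theta Q_0[F^e]\Big),\qquad F^e=dA^e+2\pi n,$$ the sum being over integer-valued 2-forms $n$ with $dn=0$. Put $$\tau=\frac{\theta}{2\pi}+2\pi i\beta,\qquad \tilde\beta=\frac{\beta}{(2\pi\beta)^2+(\theta/2\pi)^2},\qquad \tilde\theta=\frac{-\theta}{(2\pi\beta)^2+(\theta/2\pi)^2},$$ $$\vartheta\begin{bmatrix}\alpha_1\\ \alpha_2\end{bmatrix}(q,\tau)=\sum_{n\in\mathbb Z}\exp\big(i\pi(n+\alpha_1)^2\tau+2\pi i(n+\alpha_1)(q+\alpha_2)\big).$$ Then the sum and the integral defining $Z$ converge, and the following hold. 1. There is a constant $C>0$ depending only on $N$ such that for all $\beta>0$, $\theta\in\mathbb R$, $$Z[\beta,\theta]=\frac{C}{\sqrt\beta^{\,3(N^4-1)}}\left(\left|\vartheta\begin{bmatrix}0\\0\end{bmatrix}(0,2\tau)\right|^2+\left|\vartheta\begin{bmatrix}1/2\\0\end{bmatrix}(0,2\tau)\right|^2\right)^3.$$ 2. For all $\beta>0$, $\theta\in\mathbb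 R$: $\tilde\beta>0$, $-1/\tau=\frac{\tilde\theta}{2\pi}+2\pi i\tilde\beta$, and $Z[\beta,\theta]=\sqrt{\tilde\beta/\beta}^{\,3N^4}Z[\tilde\beta,\tilde\theta]$. 3. $Z[\beta,\theta+2\pi]=Z[\beta,\theta]$. 4. The function $\bar Z(\tau)=\sqrt\beta^{\,3N^4}Z[\beta,\theta]$ on the upper half plane satisfies $\bar Z\big(\frac{a\tau+b}{c\tau+d}\big)=\bar Z(\tau)$ for all $\begin{pmatrix}a&b\\c&d\end{pmatrix}\in SL(2,\mathbb Z)$. 5. Let $P_d,P_\partial,P_0$ be the orthogonal projections of real 2-forms onto $\operatorname{Im}d$, $\operatorname{Im}\partial$ and $\ker d\cap\ker\partial$, let $$Q_{NL}[F]=\frac1{8\pi^2}F\cdot\Big[P_d\,\epsilon\,P_\partial+P_\partial\,{}^t\epsilon\,P_d+P_0\frac{\epsilon+{}^t\epsilon}2P_0\Big]F,$$ and let $\tilde Q_{NL}$ be the same expression with $\epsilon$ and ${}^t\epsilon$ exchanged. For every real 1-form $A^e$ and integer 2-form $n$ with $dn=0$, $Q_{NL}[F^e]=\tilde Q_{NL}[F^e]=Q_0[F^e]$.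 6. Let $A^e$ and $A^m$ be a 1-form and a 3-form with components in $[-\pi,\pi)$, and $\int DA^eDA^m$ the integral with respect to $\prod\frac{dA^e}{2\pi}\prod\frac{dA^m}{2\pi}$; let $n,m$ run over all integer 2-forms, with no constraint, and set $F^m=\partial A^m+2\pi m$. Then for $\beta>0$, $\theta\in\mathbb R$, with all sums and integrals convergent, $$Z[\beta,\theta]=\int DA^eDA^m\sum_n\exp\Big(-\frac\beta2F^e\cdot F^e-i\theta Q_{NL}[F^e]+\frac i{2\pi}\partial A^m\cdot F^e\Big)$$ $$=\sqrt{\tilde\beta/\beta}^{\,3N^4}\int DA^eDA^m\sum_m\exp\Big(-\frac{\tilde\beta}2F^m\cdot F^m-i\tilde\theta Q_{NL}[F^m]-\frac i{2\pi}F^m\cdot dA^e\Big)$$ $$=\sqrt{\tilde\beta/\beta}^{\,3N^4}\int DA^eDA^m\sum_n\exp\Big(-\frac{\tilde\beta}2F^e\cdot F^e-i\tilde\theta\tilde Q_{NL}[F^e]+\frac i{2\pi}\partial A^m\cdot F^e\Big),$$ the last integral being the one over the fields of the dual lattice $\Lambda+\frac12(1,1,1,1)$, written with the sites of the dual lattice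 labelled by those of $\Lambda$. -/

import Mathlib

namespace VillainMaxwell

noncomputable section

/-! ### The periodic hypercubic lattice and its cells -/

/-- Sites of the four-dimensional periodic lattice with `N` sites in each direction. -/
abbrev Site (N : ℕ) := Fin 4 → ZMod N

/-- The unit lattice vector in direction `μ`. -/
def unitVec (N : ℕ) (μ : Fin 4) : Site N := Pi.single μ 1

/-- Ordered pairs of directions `μ < ν`. -/
abbrev Dir2 := {p : Fin 4 × Fin 4 // p.1 < p.2}

/-- Ordered triples of directions `μ < ν < ρ`. -/
abbrev Dir3 := {p : Fin 4 × Fin 4 × Fin 4 // p.1 < p.2.1 ∧ p.2.1 < p.2.2}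

/-- Links, plaquettes and cubes: the cells of dimension one, two and three. -/
abbrev Link (N : ℕ) := Site N × Fin 4

abbrev Plaq (N : ℕ) := Site N × Dir2

abbrev Cube (N : ℕ) := Site N × Dir3

/-! ### Lattice differential forms

An `r`-form with values in `K` is given by its components on the cells with strictly increasing
directions; the other components are determined by antisymmetry. -/

/-- The component `α_{x, μν}` of a 2-form for arbitrary `μ, ν`, by antisymmetry. -/
def comp2 {N : ℕ} {K : Type} [AddCommGroup K] (α : Plaq N → K) (x : Site N) (μ ν : Fin 4) : K :=
  if h : μ < ν then α (x, ⟨(μ, ν), h⟩)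
  else if h : ν < μ then -α (x, ⟨(ν, μ), h⟩)
  else 0

/-- The component `α_{x, μνρ}` of a 3-form for arbitrary `μ, ν, ρ`, by antisymmetry. -/
def comp3 {N : ℕ} {K : Type} [AddCommGroup K] (α : Cube N → K) (x : Site N)
    (μ ν ρ : Fin 4) : K :=
  if h : μ < ν ∧ ν < ρ then α (x, ⟨(μ, ν, ρ), h⟩)
  else if h : ν < ρ ∧ ρ < μ then α (x, ⟨(ν, ρ, μ), h⟩)
  else if h : ρ < μ ∧ μ < ν then α (x, ⟨(ρ, μ, ν), h⟩)
  else if h : ν < μ ∧ μ < ρ then -α (x, ⟨(ν, μ, ρ), h⟩)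
  else if h : μ < ρ ∧ ρ < ν then -α (x, ⟨(μ, ρ, ν), h⟩)
  else if h : ρ < ν ∧ ν < μ then -α (x, ⟨(ρ, ν, μ), h⟩)
  else 0

/-- Exterior derivative of a 1-form. -/
def d1 {N : ℕ} {K : Type} [AddCommGroup K] (A : Link N → K) : Plaq N → K :=
  fun c =>
    let x := c.1
    let μ := c.2.1.1
    let ν := c.2.1.2
    (A (x + unitVec N μ, ν) - A (x, ν)) - (A (x + unitVec N ν, μ) - A (x, μ))

/-- Exterior derivative of a 2-form. -/
def d2 {N : ℕ} {K : Type} [AddCommGroup K] (α : Plaq N → K) : Cube N → K :=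
  fun c =>
    let x := c.1
    let μ := c.2.1.1
    let ν := c.2.1.2.1
    let ρ := c.2.1.2.2
    (comp2 α (x + unitVec N μ) ν ρ - comp2 α x ν ρ)
      - (comp2 α (x + unitVec N ν) μ ρ - comp2 α x μ ρ)
      + (comp2 α (x + unitVec N ρ) μ ν - comp2 α x μ ν)

/-- Boundary operator from 2-forms to 1-forms. -/
def bd2 {N : ℕ} {K : Type} [AddCommGroup K] (α : Plaq N → K) : Link N → K :=
  fun c => ∑ ν : Fin 4, (comp2 α c.1 c.2 ν - comp2 α (c.1 - unitVec N ν) c.2 ν)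

/-- Boundary operator from 3-forms to 2-forms. -/
def bd3 {N : ℕ} {K : Type} [AddCommGroup K] (α : Cube N → K) : Plaq N → K :=
  fun c => ∑ ρ : Fin 4,
    (comp3 α c.1 c.2.1.1 c.2.1.2 ρ - comp3 α (c.1 - unitVec N ρ) c.2.1.1 c.2.1.2 ρ)

/-! ### Topological charges -/

/-- The Levi-Civita symbol on four indices: the sign of `∏_{i<j} (v_j - v_i)`. -/
def leviCivita (μ ν ρ σ : Fin 4) : ℤ :=
  Int.sign (((ν : ℤ) - μ) * ((ρ : ℤ) - μ) * ((σ : ℤ) - μ) *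
    ((ρ : ℤ) - ν) * ((σ : ℤ) - ν) * ((σ : ℤ) - ρ))

/-- The matrix `ε_{x, μν | y, ρσ} = ε_{μνρσ} δ_{x + μ + ν, y}`. -/
def epsMatrix (N : ℕ) : Matrix (Plaq N) (Plaq N) ℝ :=
  Matrix.of fun a b =>
    if a.1 + unitVec N a.2.1.1 + unitVec N a.2.1.2 = b.1 then
      (leviCivita a.2.1.1 a.2.1.2 b.2.1.1 b.2.1.2 : ℝ) else 0

/-- The ultra-local topological charge `Q₀[F] = (1 / 8π²) F · ε F = (1 / 8π²) ∑_x F ∪ F`. -/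
def Q0 {N : ℕ} [NeZero N] (F : Plaq N → ℝ) : ℝ :=
  1 / (8 * Real.pi ^ 2) * (F ⬝ᵥ (epsMatrix N).mulVec F)

/-- The image of `d` in the Euclidean space of real 2-forms. -/
def imD (N : ℕ) [NeZero N] : Submodule ℝ (EuclideanSpace ℝ (Plaq N)) :=
  Submodule.span ℝ (Set.range fun A : Link N → ℝ => WithLp.toLp 2 (d1 A))

/-- The image of `∂` in the Euclidean space of real 2-forms. -/
def imBd (N : ℕ) [NeZero N] : Submodule ℝ (EuclideanSpace ℝ (Plaq N)) :=
  Submodule.span ℝ (Set.range fun B : Cube N → ℝ => WithLp.toLp 2 (bd3 B))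

/-- The harmonic real 2-forms. -/
def harmonic (N : ℕ) [NeZero N] : Submodule ℝ (EuclideanSpace ℝ (Plaq N)) :=
  Submodule.span ℝ {α | d2 (WithLp.ofLp α) = 0 ∧ bd2 (WithLp.ofLp α) = 0}

/-- The orthogonal projection of a real 2-form onto a subspace. -/
def proj {N : ℕ} [NeZero N] (V : Submodule ℝ (EuclideanSpace ℝ (Plaq N))) (F : Plaq N → ℝ) :
    Plaq N → ℝ :=
  WithLp.ofLp (V.starProjection (WithLp.toLp 2 F))

/-- For a matrix `E` on 2-forms, the charge
`(1 / 8π²) F · [P_d E P_∂ + P_∂ ᵗE P_d + P_0 ((E + ᵗE) / 2) P_0] F`. -/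
def chargeNL {N : ℕ} [NeZero N] (E : Matrix (Plaq N) (Plaq N) ℝ) (F : Plaq N → ℝ) : ℝ :=
  1 / (8 * Real.pi ^ 2) *
    (F ⬝ᵥ (proj (imD N) (E.mulVec (proj (imBd N) F))
        + proj (imBd N) (E.transpose.mulVec (proj (imD N) F))
        + proj (harmonic N)
            (((1 / 2 : ℝ) • (E + E.transpose)).mulVec (proj (harmonic N) F))))

/-- The non-local topological charge `Q_NL`. -/
def QNL {N : ℕ} [NeZero N] (F : Plaq N → ℝ) : ℝ := chargeNL (epsMatrix N) F

/-- The non-local topological charge on the dual lattice: `ε` and `ᵗε` are exchanged. -/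
def QNLdual {N : ℕ} [NeZero N] (F : Plaq N → ℝ) : ℝ := chargeNL (epsMatrix N).transpose F

/-! ### Path integrals -/

/-- The measure `∏_i da_i / 2π` on the box `[-π, π)^ι`. -/
def boxMeasure (ι : Type) [Fintype ι] : MeasureTheory.Measure (ι → ℝ) :=
  ENNReal.ofReal ((2 * Real.pi)⁻¹ ^ Fintype.card ι) •
    (MeasureTheory.volume : MeasureTheory.Measure (ι → ℝ)).restrict
      (Set.univ.pi fun _ => Set.Ico (-Real.pi) Real.pi)

/-- The electric field strength `F^e = dA^e + 2πn`. -/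
def fieldE {N : ℕ} (A : Link N → ℝ) (n : Plaq N → ℤ) : Plaq N → ℝ :=
  fun c => d1 A c + 2 * Real.pi * (n c : ℝ)

/-- The magnetic field strength `F^m = ∂A^m + 2πm`. -/
def fieldM {N : ℕ} (B : Cube N → ℝ) (m : Plaq N → ℤ) : Plaq N → ℝ :=
  fun c => bd3 B c + 2 * Real.pi * (m c : ℝ)

/-- The integer 2-forms without monopoles, `dn = 0`. -/
abbrev ClosedForm (N : ℕ) := {n : Plaq N → ℤ // d2 n = 0}

/-- The integral over the continuous fields of the sum of `w` over the discrete fields. -/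
def pathIntegral {X ι : Type} [MeasurableSpace X] (μ : MeasureTheory.Measure X)
    (w : X → ι → ℂ) : ℂ :=
  ∫ a, ∑' n, w a n ∂μ

/-- The sum over discrete fields converges for all continuous fields, and the integral of the
resulting function converges. -/
def PathConvergent {X ι : Type} [MeasurableSpace X] (μ : MeasureTheory.Measure X)
    (w : X → ι → ℂ) : Prop :=
  (∀ a, Summable (w a)) ∧ MeasureTheory.Integrable (fun a => ∑' n, w a n) μ

/-- The ultra-local Boltzmann weight `exp(-(β/2) F·F - iθ Q[F])` for a charge `Q`. -/
def boltzmann {N : ℕ} [NeZero N] (Q : (Plaq N → ℝ) → ℝ) (β θ : ℝ) (F : Plaq N → ℝ) : ℂ :=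
  Complex.exp (-((β / 2 * (F ⬝ᵥ F) : ℝ) : ℂ) - Complex.I * ((θ * Q F : ℝ) : ℂ))

/-- The weight of the ultra-local modified Villain model, on closed `n`. -/
def weight {N : ℕ} [NeZero N] (β θ : ℝ) (A : Link N → ℝ) (n : ClosedForm N) : ℂ :=
  boltzmann Q0 β θ (fieldE A n.1)

/-- The partition function `Z[β, θ]`. -/
def Z (N : ℕ) [NeZero N] (β θ : ℝ) : ℂ :=
  pathIntegral (boxMeasure (Link N)) (weight β θ)

/-- The weight with magnetic gauge field `A^m` in place of the closedness constraint:
`exp(-(β/2) F·F - iθ Q[F] + (i/2π) ∂A^m · F)` with `F = dA^e + 2πn`. -/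
def weightE {N : ℕ} [NeZero N] (Q : (Plaq N → ℝ) → ℝ) (β θ : ℝ)
    (AB : (Link N → ℝ) × (Cube N → ℝ)) (n : Plaq N → ℤ) : ℂ :=
  boltzmann Q β θ (fieldE AB.1 n) *
    Complex.exp (Complex.I * ((1 / (2 * Real.pi) * (bd3 AB.2 ⬝ᵥ fieldE AB.1 n) : ℝ) : ℂ))

/-- The Poisson-dual weight `exp(-(β/2) F·F - iθ Q[F] - (i/2π) F · dA^e)` with
`F = ∂A^m + 2πm`. -/
def weightM {N : ℕ} [NeZero N] (Q : (Plaq N → ℝ) → ℝ) (β θ : ℝ)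
    (AB : (Link N → ℝ) × (Cube N → ℝ)) (m : Plaq N → ℤ) : ℂ :=
  boltzmann Q β θ (fieldM AB.2 m) *
    Complex.exp (-(Complex.I * ((1 / (2 * Real.pi) * (fieldM AB.2 m ⬝ᵥ d1 AB.1) : ℝ) : ℂ)))

/-- The measure `DA^e DA^m`. -/
def boxMeasureEM (N : ℕ) [NeZero N] :
    MeasureTheory.Measure ((Link N → ℝ) × (Cube N → ℝ)) :=
  (boxMeasure (Link N)).prod (boxMeasure (Cube N))

/-! ### Couplings, theta functions, modular form of the partition function -/

/-- The complex coupling `τ = θ/2π + 2πiβ`. -/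
def tau (β θ : ℝ) : ℂ := (θ : ℂ) / (2 * Real.pi) + Complex.I * (2 * Real.pi * β)

/-- The dual couplings `β̃` and `θ̃`. -/
def dualBeta (β θ : ℝ) : ℝ := β / ((2 * Real.pi * β) ^ 2 + (θ / (2 * Real.pi)) ^ 2)

def dualTheta (β θ : ℝ) : ℝ := -θ / ((2 * Real.pi * β) ^ 2 + (θ / (2 * Real.pi)) ^ 2)

/-- The theta function with characteristics. -/
def thetaChar (α₁ α₂ : ℝ) (q τ : ℂ) : ℂ :=
  ∑' n : ℤ, Complex.exp (Complex.I * Real.pi * ((n : ℂ) + α₁) ^ 2 * τ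
    + 2 * Complex.I * Real.pi * ((n : ℂ) + α₁) * (q + α₂))

/-- The rescaled partition function `Z̄(τ) = √β^{3N⁴} Z[β, θ]` with `β = Im τ / 2π` and
`θ = 2π Re τ`. -/
def Zbar (N : ℕ) [NeZero N] (τ : UpperHalfPlane) : ℂ :=
  ((Real.sqrt (τ.im / (2 * Real.pi)) ^ (3 * N ^ 4) : ℝ) : ℂ) *
    Z N (τ.im / (2 * Real.pi)) (2 * Real.pi * τ.re)

end

end VillainMaxwell

namespace VillainMaxwell

noncomputable section

open Function MeasureTheory

/-! Everything reduces to the cohomology of the four-torus. A closed integer 2-form is an exact one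
plus a form carrying six integer fluxes, uniquely (`exists_eq_d1_add_fluxForm`, `fluxEquiv`). The
sum over the exact part unfolds the box integral over `A`: the law of `dA + 2πe`, summed over exact
`e`, is a translation-invariant, locally finite measure on Im d, hence a multiple of Lebesgue
measure. Its Gaussian integral is a constant times `√β ^ -dim Im d` whatever the centre
(`exists_hasSum_exact`), and `finrank_imD` gives dim Im d = 3(N⁴ - 1).

What remains is a sum over fluxes. A flux form is cohomologous to a constant form, which is
harmonic, so its energy decouples from the exact part; the charge sees only the cohomology class,
because `ε` intertwines `d` and `∂` (`star2_quadratic_add_d1`). The flux charge is the intersection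
form of the torus, three hyperbolic planes, so the sum is the cube of a sum over ℤ² (`exists_Z_eq`).
Splitting ℤ² by parity turns the latter into a sum of two squared theta norms (`tsum_pairWeight`).
Jacobi's functional equation and the parallelogram law give the factor `|τ|` under `τ ↦ -1/τ`
(`thetaSum_S`), integrality of the charge gives `τ ↦ τ + 1`, and these two generate the modular
group.

For the integrals with both gauge fields, one of the fields enters only through a phase and
integrates to the constraint `dn = 0` or `∂m = 0`. On closed or coclosed fields the non-local charge
reduces to the harmonic part, hence to `Q0`. Thus each of the three integrals is `Z` at its own
couplings, and the duality between them is the S-duality of `Z`; no Poisson resummation of the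
non-local weight is needed. -/

theorem sum_dir2 {M : Type*} [AddCommMonoid M] (f : Dir2 → M) :
    ∑ p, f p = f ⟨(0, 1), by decide⟩ + f ⟨(0, 2), by decide⟩ + f ⟨(0, 3), by decide⟩
      + f ⟨(1, 2), by decide⟩ + f ⟨(1, 3), by decide⟩ + f ⟨(2, 3), by decide⟩ := by
  have h : (Finset.univ : Finset Dir2) = {⟨(0, 1), by decide⟩, ⟨(0, 2), by decide⟩,
      ⟨(0, 3), by decide⟩, ⟨(1, 2), by decide⟩, ⟨(1, 3), by decide⟩, ⟨(2, 3), by decide⟩} := by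
    decide
  rw [h]
  simp [add_assoc]

theorem sum_dir3 {M : Type*} [AddCommMonoid M] (f : Dir3 → M) :
    ∑ p, f p = f ⟨(0, 1, 2), by decide⟩ + f ⟨(0, 1, 3), by decide⟩ + f ⟨(0, 2, 3), by decide⟩
      + f ⟨(1, 2, 3), by decide⟩ := by
  have h : (Finset.univ : Finset Dir3) = {⟨(0, 1, 2), by decide⟩, ⟨(0, 1, 3), by decide⟩,
      ⟨(0, 2, 3), by decide⟩, ⟨(1, 2, 3), by decide⟩} := by
    decide
  rw [h]
  simp [add_assoc]

theorem dir2_cases {P : Dir2 → Prop} (h01 : P ⟨(0, 1), by decide⟩) (h02 : P ⟨(0, 2), by decide⟩)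
    (h03 : P ⟨(0, 3), by decide⟩) (h12 : P ⟨(1, 2), by decide⟩) (h13 : P ⟨(1, 3), by decide⟩)
    (h23 : P ⟨(2, 3), by decide⟩) (p : Dir2) : P p := by
  rcases p with ⟨⟨μ, ν⟩, h⟩
  fin_cases μ <;> fin_cases ν <;> first | assumption | exact absurd h (by decide)

theorem dir3_cases {P : Dir3 → Prop} (h012 : P ⟨(0, 1, 2), by decide⟩)
    (h013 : P ⟨(0, 1, 3), by decide⟩) (h023 : P ⟨(0, 2, 3), by decide⟩)
    (h123 : P ⟨(1, 2, 3), by decide⟩) (p : Dir3) : P p := by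
  rcases p with ⟨⟨μ, ν, ρ⟩, h⟩
  fin_cases μ <;> fin_cases ν <;> fin_cases ρ <;> first | assumption | exact absurd h (by decide)

/-! ### Functoriality and additivity of the lattice operators; `d² = 0` and `∂² = 0` -/

section Maps

variable {N : ℕ} {K L : Type} [AddCommGroup K] [AddCommGroup L]

theorem comp2_map (f : K →+ L) (α : Plaq N → K) (x : Site N) (μ ν : Fin 4) :
    comp2 (fun c => f (α c)) x μ ν = f (comp2 α x μ ν) := by
  unfold comp2
  split_ifs <;> simp

theorem comp3_map (f : K →+ L) (α : Cube N → K) (x : Site N) (μ ν ρ : Fin 4) :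
    comp3 (fun c => f (α c)) x μ ν ρ = f (comp3 α x μ ν ρ) := by
  unfold comp3
  split_ifs <;> simp

theorem comp2_add (α α' : Plaq N → K) (x : Site N) (μ ν : Fin 4) :
    comp2 (α + α') x μ ν = comp2 α x μ ν + comp2 α' x μ ν := by
  unfold comp2
  split_ifs <;> simp [add_comm]

theorem comp3_add (α α' : Cube N → K) (x : Site N) (μ ν ρ : Fin 4) :
    comp3 (α + α') x μ ν ρ = comp3 α x μ ν ρ + comp3 α' x μ ν ρ := by
  unfold comp3
  split_ifs <;> simp [add_comm]

theorem comp2_swap (α : Plaq N → K) (x : Site N) (μ ν : Fin 4) :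
    comp2 α x μ ν = -comp2 α x ν μ := by
  unfold comp2
  rcases lt_trichotomy μ ν with h | h | h
  · simp [h, h.not_gt]
  · simp [h]
  · simp [h, h.not_gt]

theorem comp2_of_lt (α : Plaq N → K) (x : Site N) (p : Dir2) :
    comp2 α x p.1.1 p.1.2 = α (x, p) := by
  simp [comp2, p.2]

theorem d1_map (f : K →+ L) (A : Link N → K) : d1 (fun c => f (A c)) = fun c => f (d1 A c) := by
  funext c; simp [d1]

theorem d2_map (f : K →+ L) (α : Plaq N → K) : d2 (fun c => f (α c)) = fun c => f (d2 α c) := by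
  funext c; simp [d2, comp2_map f]

theorem bd2_map (f : K →+ L) (α : Plaq N → K) :
    bd2 (fun c => f (α c)) = fun c => f (bd2 α c) := by
  funext c; simp [bd2, comp2_map f]

theorem bd3_map (f : K →+ L) (α : Cube N → K) :
    bd3 (fun c => f (α c)) = fun c => f (bd3 α c) := by
  funext c; simp [bd3, comp3_map f]

theorem d1_add (A B : Link N → K) : d1 (A + B) = d1 A + d1 B := by
  funext c; simp only [d1, Pi.add_apply]; abel

theorem d2_add (A B : Plaq N → K) : d2 (A + B) = d2 A + d2 B := by
  funext c; simp only [d2, comp2_add, Pi.add_apply]; abel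

theorem bd2_add (A B : Plaq N → K) : bd2 (A + B) = bd2 A + bd2 B := by
  funext c
  simp only [bd2, comp2_add, Pi.add_apply, ← Finset.sum_add_distrib]
  exact Finset.sum_congr rfl fun ν _ => by abel

theorem bd3_add (A B : Cube N → K) : bd3 (A + B) = bd3 A + bd3 B := by
  funext c
  simp only [bd3, comp3_add, Pi.add_apply, ← Finset.sum_add_distrib]
  exact Finset.sum_congr rfl fun ν _ => by abel

/-- The exterior derivative of 1-forms as a homomorphism. -/
def d1Hom (N : ℕ) (K : Type) [AddCommGroup K] : (Link N → K) →+ (Plaq N → K) :=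
  AddMonoidHom.mk' d1 d1_add

/-- The exterior derivative of 2-forms as a homomorphism. -/
def d2Hom (N : ℕ) (K : Type) [AddCommGroup K] : (Plaq N → K) →+ (Cube N → K) :=
  AddMonoidHom.mk' d2 d2_add

theorem d2_sub (A B : Plaq N → K) : d2 (A - B) = d2 A - d2 B := map_sub (d2Hom N K) A B

theorem d2_d1 (A : Link N → K) : d2 (d1 A) = 0 := by
  funext ⟨x, p⟩
  have h (μ ν : Fin 4) : x + unitVec N μ + unitVec N ν = x + unitVec N ν + unitVec N μ :=
    add_right_comm _ _ _
  induction p using dir3_cases <;>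
  · simp [d2, d1, comp2, h 1 0, h 2 0, h 3 0, h 2 1, h 3 1, h 3 2]
    abel

theorem bd2_bd3 (B : Cube N → K) : bd2 (bd3 B) = 0 := by
  funext ⟨x, μ⟩
  fin_cases μ <;>
  · simp [bd2, bd3, comp2, comp3, Fin.sum_univ_four, sub_right_comm]
    try abel

end Maps

/-! ### Second cohomology of the discrete four-torus over a commutative ring -/

section Cohomology

variable {N : ℕ} {K : Type} [CommRing K]

theorem update_add_unitVec_of_ne {l m : Fin 4} (h : m ≠ l) (x : Site N) (a : ZMod N) :
    update (x + unitVec N m) l a = update x l a + unitVec N m := by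
  funext i
  by_cases hi : i = l
  · subst hi; simp [unitVec, h.symm]
  · simp [hi]

theorem update_add_unitVec_self (l : Fin 4) (x : Site N) (a : ZMod N) :
    update (x + unitVec N l) l a = update x l a := by
  funext i
  by_cases hi : i = l
  · subst hi; simp
  · simp [hi, unitVec]

theorem update_unitVec_self (l : Fin 4) (x : Site N) (a : ZMod N) :
    update x l a + unitVec N l = update x l (a + 1) := by
  funext i
  by_cases hi : i = l
  · subst hi; simp [unitVec]
  · simp [hi, unitVec]

/-- The sum of `f` over the sites that precede `x` on its line in direction `l`. -/
def partialSum (l : Fin 4) (f : Site N → K) (x : Site N) : K :=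
  ∑ a ∈ Finset.range (x l).val, f (update x l (a : ZMod N))

theorem partialSum_shift {l m : Fin 4} (h : m ≠ l) (f : Site N → K) (x : Site N) :
    partialSum l f (x + unitVec N m) = partialSum l (fun y => f (y + unitVec N m)) x := by
  simp only [partialSum, update_add_unitVec_of_ne h]
  simp [unitVec, h.symm]

theorem partialSum_sub (l : Fin 4) (f g : Site N → K) (x : Site N) :
    partialSum l (fun y => f y - g y) x = partialSum l f x - partialSum l g x := by
  simp [partialSum]

theorem sum_range_zmod [NeZero N] (f : ZMod N → K) :
    ∑ a ∈ Finset.range N, f (a : ZMod N) = ∑ a, f a := by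
  refine Finset.sum_bij (fun a _ => (a : ZMod N)) (by simp) ?_ ?_ (by simp)
  · intro a ha b hb h
    rw [Finset.mem_range] at ha hb
    rwa [ZMod.natCast_eq_natCast_iff', Nat.mod_eq_of_lt ha, Nat.mod_eq_of_lt hb] at h
  · intro b _
    exact ⟨b.val, Finset.mem_range.2 (ZMod.val_lt b), ZMod.natCast_zmod_val b⟩

/-- The partial sums form a primitive of `f` except on the last site of the line, where the sum
wraps around and the total over the circle appears as a defect. -/
theorem diff_partialSum [NeZero N] (l : Fin 4) (f : Site N → K) (x : Site N) :
    partialSum l f (x + unitVec N l) - partialSum l f x =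
      f x - if x l = -1 then ∑ a, f (update x l a) else 0 := by
  have hx : f x = f (update x l (((x l).val : ℕ) : ZMod N)) := by simp
  have hlt := ZMod.val_lt (x l)
  simp only [partialSum, update_add_unitVec_self]
  have hxl : (x + unitVec N l) l = x l + 1 := by simp [unitVec]
  rw [hxl]
  split_ifs with h
  · have hv : (x l).val + 1 = N := by
      have h1 : (((x l).val + 1 : ℕ) : ZMod N) = 0 := by simp [h]
      rw [ZMod.natCast_eq_zero_iff] at h1
      exact le_antisymm hlt (Nat.le_of_dvd (Nat.succ_pos _) h1)
    have hr : Finset.range N = Finset.range ((x l).val + 1) := by rw [hv]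
    have h0 : x l + 1 = 0 := by rw [h, neg_add_cancel]
    rw [← sum_range_zmod, hr, Finset.sum_range_succ, h0, ← hx]
    simp only [ZMod.val_zero, Finset.range_zero, Finset.sum_empty]
    ring
  · have hv : (x l + 1).val = (x l).val + 1 := by
      have h1 : (x l).val + 1 ≠ N := by
        intro h2
        apply h
        have h3 : (((x l).val + 1 : ℕ) : ZMod N) = 0 := by rw [h2]; simp
        push_cast at h3
        rw [ZMod.natCast_zmod_val] at h3
        exact eq_neg_of_add_eq_zero_left h3
      have h4 : (((x l).val + 1 : ℕ) : ZMod N) = x l + 1 := by simp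
      rw [← h4, ZMod.val_natCast_of_lt (by omega)]
    rw [hv, Finset.sum_range_succ, ← hx]
    ring

theorem partialSum_diff [NeZero N] (l : Fin 4) (f : Site N → K) (x : Site N) :
    partialSum l (fun y => f (y + unitVec N l) - f y) x = f x - f (update x l 0) := by
  have hx : f x = f (update x l (((x l).val : ℕ) : ZMod N)) := by simp
  rw [hx]
  have h (a : ℕ) : f (update x l (a : ZMod N) + unitVec N l)
      = f (update x l ((a + 1 : ℕ) : ZMod N)) := by
    rw [update_unitVec_self]; push_cast; rfl
  simp only [partialSum, h]
  rw [Finset.sum_range_sub (fun a : ℕ => f (update x l (a : ZMod N)))]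
  simp

/-- The 2-form cohomologous to a closed form that is constant in direction `l`, or supported on
the last hyperplane if it has a leg in direction `l`. -/
def collapse [NeZero N] (l : Fin 4) (F : Plaq N → K) : Plaq N → K := fun c =>
  if l = c.2.1.1 ∨ l = c.2.1.2 then
    if c.1 l = -1 then ∑ a, F (update c.1 l a, c.2) else 0
  else F (update c.1 l 0, c.2)

/-- The homotopy in direction `l` needs closedness with `l` in first place, wherever `l` stands in
the order of directions. -/
theorem comp2_closed {F : Plaq N → K} (hF : d2 F = 0) (l m n : Fin 4) (x : Site N) :
    (comp2 F (x + unitVec N l) m n - comp2 F x m n)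
      - (comp2 F (x + unitVec N m) l n - comp2 F x l n)
      + (comp2 F (x + unitVec N n) l m - comp2 F x l m) = 0 := by
  have h012 := congrFun hF (x, ⟨(0, 1, 2), by decide⟩)
  have h013 := congrFun hF (x, ⟨(0, 1, 3), by decide⟩)
  have h023 := congrFun hF (x, ⟨(0, 2, 3), by decide⟩)
  have h123 := congrFun hF (x, ⟨(1, 2, 3), by decide⟩)
  have hs (μ : Fin 4) (y : Site N) : comp2 F y μ μ = 0 := by simp [comp2]
  simp only [d2, Pi.zero_apply] at h012 h013 h023 h123
  have s10 (y : Site N) := comp2_swap F y 1 0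
  have s20 (y : Site N) := comp2_swap F y 2 0
  have s30 (y : Site N) := comp2_swap F y 3 0
  have s21 (y : Site N) := comp2_swap F y 2 1
  have s31 (y : Site N) := comp2_swap F y 3 1
  have s32 (y : Site N) := comp2_swap F y 3 2
  fin_cases l <;> fin_cases m <;> fin_cases n <;>
  · simp only [Fin.zero_eta, Fin.mk_one, Fin.reduceFinMk, hs, s10, s20, s30, s21, s31, s32]
    first
    | ring1
    | linear_combination h012
    | linear_combination h013
    | linear_combination h023
    | linear_combination h123
    | linear_combination -h012
    | linear_combination -h013
    | linear_combination -h023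
    | linear_combination -h123

/-- A homotopy formula: contract `F` with direction `l` and integrate along `l` from the hyperplane
`x l = 0`. On plaquettes with a leg in direction `l` the primitive returns `F` up to the wrap-around
defect. On the others closedness turns the derivative into a difference in direction `l`, which
telescopes down to the hyperplane. -/
theorem sub_collapse_exact [NeZero N] {F : Plaq N → K} (hF : d2 F = 0) (l : Fin 4) :
    F - collapse l F = d1 fun c => partialSum l (fun y => comp2 F y l c.2) c.1 := by
  have hs (y : Site N) (μ : Fin 4) : comp2 F y μ μ = 0 := by simp [comp2]
  have hz (x : Site N) : partialSum l (fun y => comp2 F y l l) x = 0 := by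
    simp [partialSum, hs]
  funext ⟨x, p⟩
  simp only [Pi.sub_apply, collapse, d1]
  by_cases h1 : l = p.1.1
  · have h := diff_partialSum l (fun y => comp2 F y l p.1.2) x
    rw [← h1, hz, hz, h]
    simp only [h1, comp2_of_lt]
    simp
  by_cases h2 : l = p.1.2
  · have h := diff_partialSum l (fun y => comp2 F y l p.1.1) x
    rw [← h2, hz, hz, h]
    have hc (y : Site N) : comp2 F y l p.1.1 = -F (y, p) := by
      rw [comp2_swap, h2, comp2_of_lt]
    simp only [hc]
    simp only [h2, or_true, if_true, Finset.sum_neg_distrib]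
    split_ifs <;> ring
  · rw [partialSum_shift (Ne.symm h1), partialSum_shift (Ne.symm h2), ← partialSum_sub,
      ← partialSum_sub, ← partialSum_sub]
    simp only [h1, h2, or_self, if_false]
    have h := partialSum_diff l (fun y => comp2 F y p.1.1 p.1.2) x
    rw [comp2_of_lt, comp2_of_lt] at h
    rw [← h]
    congr 1
    funext y
    linear_combination comp2_closed hF l p.1.1 p.1.2 y

theorem collapse_closed [NeZero N] {F : Plaq N → K} (hF : d2 F = 0) (l : Fin 4) : d2 (collapse l F) = 0 := by
  have h := congrArg d2 (sub_collapse_exact hF l)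
  rwa [d2_sub, d2_d1, hF, zero_sub, neg_eq_zero] at h

/-- The flux of a 2-form through the coordinate tori through the origin. -/
def period [NeZero N] (F : Plaq N → K) (p : Dir2) : K :=
  ∑ a : ZMod N, ∑ b : ZMod N, F (fun i => if i = p.1.1 then a else if i = p.1.2 then b else 0, p)

/-- The closed 2-form with prescribed fluxes supported on the last coordinate tori. -/
def fluxForm (N : ℕ) (c : Dir2 → K) : Plaq N → K := fun q =>
  if q.1 q.2.1.1 = -1 ∧ q.1 q.2.1.2 = -1 then c q.2 else 0

theorem collapse_all [NeZero N] (F : Plaq N → K) :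
    collapse 3 (collapse 2 (collapse 1 (collapse 0 F))) = fluxForm N (period F) := by
  funext ⟨x, p⟩
  induction p using dir2_cases <;>
  · simp only [collapse, fluxForm, period]
    simp [← ite_and]
    refine if_congr and_comm ?_ rfl
    rw [Finset.sum_comm]
    refine Finset.sum_congr rfl fun a _ => Finset.sum_congr rfl fun b _ => ?_
    congr 2
    funext i
    fin_cases i <;> rfl

/-- Collapse in all four directions, each step changing the form by an exact one. The ring is
arbitrary, so the same lemma serves over ℤ for the sum over `n` and over ℝ for the dimension count.
-/
theorem exists_eq_d1_add_fluxForm [NeZero N] {F : Plaq N → K} (hF : d2 F = 0) :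
    ∃ A : Link N → K, F = d1 A + fluxForm N (period F) := by
  have step (l : Fin 4) {G : Plaq N → K} (hG : d2 G = 0) :
      ∃ A : Link N → K, G = d1 A + collapse l G :=
    ⟨_, eq_add_of_sub_eq (sub_collapse_exact hG l)⟩
  obtain ⟨A0, h0⟩ := step 0 hF
  obtain ⟨A1, h1⟩ := step 1 (collapse_closed hF 0)
  obtain ⟨A2, h2⟩ := step 2 (collapse_closed (collapse_closed hF 0) 1)
  obtain ⟨A3, h3⟩ := step 3 (collapse_closed (collapse_closed (collapse_closed hF 0) 1) 2)
  rw [collapse_all] at h3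
  refine ⟨A0 + A1 + A2 + A3, ?_⟩
  rw [d1_add, d1_add, d1_add, add_assoc, ← h3, add_assoc, ← h2, add_assoc, ← h1, ← h0]

theorem period_add [NeZero N] (F G : Plaq N → K) : period (F + G) = period F + period G := by
  funext p; simp [period, Finset.sum_add_distrib]

/-- Stokes on a closed torus: the sum over the torus is invariant under unit shifts along it. -/
theorem period_d1 [NeZero N] (A : Link N → K) : period (d1 A) = 0 := by
  funext p
  have hne : p.1.2 ≠ p.1.1 := p.2.ne'
  simp only [period, d1, Finset.sum_sub_distrib, Pi.zero_apply]
  have h1 (a b : ZMod N) : (fun i => if i = p.1.1 then a else if i = p.1.2 then b else 0)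
      + unitVec N p.1.1 = (fun i => if i = p.1.1 then a + 1 else if i = p.1.2 then b else 0) := by
    funext i
    by_cases h : i = p.1.1 <;> simp [unitVec, h]
  have h2 (a b : ZMod N) : (fun i => if i = p.1.1 then a else if i = p.1.2 then b else 0)
      + unitVec N p.1.2 = (fun i => if i = p.1.1 then a else if i = p.1.2 then b + 1 else 0) := by
    funext i
    by_cases h : i = p.1.1
    · simp [unitVec, h, hne.symm]
    · by_cases h' : i = p.1.2
      · subst h'; simp [unitVec, h]
      · simp [unitVec, h, h']
  simp only [h1, h2]
  have h4 := Equiv.sum_comp (Equiv.addRight (1 : ZMod N)) (fun a => ∑ b : ZMod N,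
    A (fun i => if i = p.1.1 then a else if i = p.1.2 then b else 0, p.1.2))
  have h3 (a : ZMod N) := Equiv.sum_comp (Equiv.addRight (1 : ZMod N)) (fun b =>
    A (fun i => if i = p.1.1 then a else if i = p.1.2 then b else 0, p.1.1))
  simp only [Equiv.coe_addRight] at h3 h4
  simp only [h3, h4]
  simp

theorem period_fluxForm [NeZero N] (c : Dir2 → K) : period (fluxForm N c) = c := by
  funext p
  simp [period, fluxForm, p.2.ne', ite_and]

theorem period_const [NeZero N] (c : Dir2 → K) : period (fun q : Plaq N => c q.2) = (N : K) ^ 2 • c := by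
  funext p
  simp [period, ZMod.card]
  ring

/-- A component `μν` depends only on the coordinates `x μ` and `x ν`, while `d` differentiates it
only in a third direction. -/
theorem d2_fluxForm (c : Dir2 → K) : d2 (fluxForm N c) = 0 := by
  funext ⟨x, p⟩
  induction p using dir3_cases <;>
  · simp [d2, comp2, fluxForm, unitVec]

theorem d2_const (c : Dir2 → K) : d2 (fun q : Plaq N => c q.2) = 0 := by
  funext ⟨x, p⟩
  simp [d2, comp2]

theorem bd2_const (c : Dir2 → K) : bd2 (fun q : Plaq N => c q.2) = 0 := by
  funext ⟨x, p⟩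
  simp [bd2, comp2]

end Cohomology

/-! ### The duality of cells -/

section Star

variable {N : ℕ} {K : Type} [CommRing K]

/-- The action of the matrix `ε` on 2-forms. -/
def star2 (F : Plaq N → K) : Plaq N → K := fun c =>
  ∑ p : Dir2, (leviCivita c.2.1.1 c.2.1.2 p.1.1 p.1.2 : K) *
    F (c.1 + unitVec N c.2.1.1 + unitVec N c.2.1.2, p)

/-- The inverse of `star2`. -/
def star2Inv (F : Plaq N → K) : Plaq N → K := fun c =>
  ∑ p : Dir2, (leviCivita p.1.1 p.1.2 c.2.1.1 c.2.1.2 : K) *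
    F (c.1 - unitVec N p.1.2 - unitVec N p.1.1, p)

theorem star2_apply (F : Plaq N → K) (x : Site N) :
    star2 F (x, ⟨(0, 1), by decide⟩) = F (x + unitVec N 0 + unitVec N 1, ⟨(2, 3), by decide⟩) ∧
    star2 F (x, ⟨(0, 2), by decide⟩) = -F (x + unitVec N 0 + unitVec N 2, ⟨(1, 3), by decide⟩) ∧
    star2 F (x, ⟨(0, 3), by decide⟩) = F (x + unitVec N 0 + unitVec N 3, ⟨(1, 2), by decide⟩) ∧
    star2 F (x, ⟨(1, 2), by decide⟩) = F (x + unitVec N 1 + unitVec N 2, ⟨(0, 3), by decide⟩) ∧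
    star2 F (x, ⟨(1, 3), by decide⟩) = -F (x + unitVec N 1 + unitVec N 3, ⟨(0, 2), by decide⟩) ∧
    star2 F (x, ⟨(2, 3), by decide⟩) = F (x + unitVec N 2 + unitVec N 3, ⟨(0, 1), by decide⟩) := by
  refine ⟨?_, ?_, ?_, ?_, ?_, ?_⟩ <;> simp [star2, sum_dir2, leviCivita,
    show Int.sign 2 = 1 from rfl, show Int.sign 3 = 1 from rfl]

theorem star2Inv_apply (F : Plaq N → K) (x : Site N) :
    star2Inv F (x, ⟨(0, 1), by decide⟩) =
      F (x - unitVec N 3 - unitVec N 2, ⟨(2, 3), by decide⟩) ∧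
    star2Inv F (x, ⟨(0, 2), by decide⟩) =
      -F (x - unitVec N 3 - unitVec N 1, ⟨(1, 3), by decide⟩) ∧
    star2Inv F (x, ⟨(0, 3), by decide⟩) =
      F (x - unitVec N 2 - unitVec N 1, ⟨(1, 2), by decide⟩) ∧
    star2Inv F (x, ⟨(1, 2), by decide⟩) =
      F (x - unitVec N 3 - unitVec N 0, ⟨(0, 3), by decide⟩) ∧
    star2Inv F (x, ⟨(1, 3), by decide⟩) =
      -F (x - unitVec N 2 - unitVec N 0, ⟨(0, 2), by decide⟩) ∧
    star2Inv F (x, ⟨(2, 3), by decide⟩) =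
      F (x - unitVec N 1 - unitVec N 0, ⟨(0, 1), by decide⟩) := by
  refine ⟨?_, ?_, ?_, ?_, ?_, ?_⟩ <;> simp [star2Inv, sum_dir2, leviCivita,
    show Int.sign 2 = 1 from rfl, show Int.sign 3 = 1 from rfl]

theorem star2_star2Inv (F : Plaq N → K) : star2 (star2Inv F) = F := by
  funext ⟨x, p⟩
  obtain ⟨h1, h2, h3, h4, h5, h6⟩ := star2_apply (star2Inv F) x
  induction p using dir2_cases
  all_goals simp only [h1, h2, h3, h4, h5, h6, star2Inv_apply]; simp

theorem star2Inv_star2 (F : Plaq N → K) : star2Inv (star2 F) = F := by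
  funext ⟨x, p⟩
  obtain ⟨h1, h2, h3, h4, h5, h6⟩ := star2Inv_apply (star2 F) x
  induction p using dir2_cases
  all_goals simp only [h1, h2, h3, h4, h5, h6, star2_apply]; simp

theorem star2_bijective : Bijective (star2 : (Plaq N → K) → Plaq N → K) :=
  bijective_iff_has_inverse.2 ⟨star2Inv, star2Inv_star2, star2_star2Inv⟩

theorem star2_add (F G : Plaq N → K) : star2 (F + G) = star2 F + star2 G := by
  funext c; simp [star2, mul_add, Finset.sum_add_distrib]

theorem star2_smul (r : K) (F : Plaq N → K) : star2 (r • F) = r • star2 F := by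
  funext c; simp [star2, Finset.mul_sum, mul_left_comm]

theorem star2_intCast (n : Plaq N → ℤ) :
    star2 (fun c => (n c : ℝ)) = fun c => ((star2 n c : ℤ) : ℝ) := by
  funext c; simp [star2]

/-- The direction complementary to three given ones. -/
def dir3Compl (p : Dir3) : Fin 4 := 2 - p.1.1 - p.1.2.1 - p.1.2.2

/-- The four directions add up to 6, which is 2 in `Fin 4`; this is the 2 from which the three
directions are subtracted. -/
theorem dir3Compl_bijective : Bijective dir3Compl := by
  constructor
  · intro p q
    revert p q
    decide
  · intro μ
    revert μ
    decide

/-- The correspondence of cubes with the dual links. -/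
def cubeLink (N : ℕ) : Cube N ≃ Link N where
  toFun c := (c.1 + unitVec N c.2.1.1 + unitVec N c.2.1.2.1 + unitVec N c.2.1.2.2,
    dir3Compl c.2)
  invFun l :=
    let p := (Equiv.ofBijective _ dir3Compl_bijective).symm l.2
    (l.1 - unitVec N p.1.2.2 - unitVec N p.1.2.1 - unitVec N p.1.1, p)
  left_inv c := by simp
  right_inv l := Prod.ext (by simp)
    (Equiv.ofBijective_apply_symm_apply dir3Compl dir3Compl_bijective l.2)

/-- The sign of a cube relative to its dual link. -/
def cubeSign (c : Cube N) : ℤ :=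
  leviCivita c.2.1.1 c.2.1.2.1 c.2.1.2.2 (dir3Compl c.2)

theorem cubeSign_eq (c : Cube N) : cubeSign c = 1 ∨ cubeSign c = -1 := by
  rcases c with ⟨x, p⟩
  simp only [cubeSign]
  revert p
  decide

/-- The 3-form dual to a 1-form. -/
def star1 (A : Link N → K) : Cube N → K := fun c => (cubeSign c : K) * A (cubeLink N c)

theorem star1_apply (A : Link N → K) (x : Site N) :
    star1 A (x, ⟨(0, 1, 2), by decide⟩) =
      A (x + unitVec N 0 + unitVec N 1 + unitVec N 2, 3) ∧
    star1 A (x, ⟨(0, 1, 3), by decide⟩) =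
      -A (x + unitVec N 0 + unitVec N 1 + unitVec N 3, 2) ∧
    star1 A (x, ⟨(0, 2, 3), by decide⟩) =
      A (x + unitVec N 0 + unitVec N 2 + unitVec N 3, 1) ∧
    star1 A (x, ⟨(1, 2, 3), by decide⟩) =
      -A (x + unitVec N 1 + unitVec N 2 + unitVec N 3, 0) := by
  have h1 : dir3Compl ⟨(0, 1, 2), by decide⟩ = 3 := by decide
  have h2 : dir3Compl ⟨(0, 1, 3), by decide⟩ = 2 := by decide
  have h3 : dir3Compl ⟨(0, 2, 3), by decide⟩ = 1 := by decide
  have h4 : dir3Compl ⟨(1, 2, 3), by decide⟩ = 0 := by decide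
  refine ⟨?_, ?_, ?_, ?_⟩ <;> simp [star1, cubeSign, cubeLink, h1, h2, h3, h4, leviCivita,
    show Int.sign 12 = 1 from rfl]

/-- The lattice form of `∂⋆ = ⋆d`. Both stars move a cell by the sum of its own directions, and with
these shifts the rule holds without extra sign or translation. -/
theorem bd3_star1 (A : Link N → K) : bd3 (star1 A) = star2 (d1 A) := by
  funext ⟨x, p⟩
  obtain ⟨h1, h2, h3, h4, h5, h6⟩ := star2_apply (d1 A) x
  have h (μ ν : Fin 4) (x : Site N) :
      x - unitVec N μ + unitVec N ν = x + unitVec N ν - unitVec N μ := sub_add_eq_add_sub _ _ _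
  have hc (μ ν : Fin 4) (x : Site N) :
      x + unitVec N μ + unitVec N ν = x + unitVec N ν + unitVec N μ := add_right_comm _ _ _
  induction p using dir2_cases
  all_goals
    simp only [h1, h2, h3, h4, h5, h6]
    simp [bd3, comp3, Fin.sum_univ_four, star1_apply, d1, h, hc 1 0, hc 2 0, hc 3 0, hc 2 1,
      hc 3 1, hc 3 2]
    try abel

/-- The same rule one degree higher, now with signs and a translation; only the correspondence of
kernels is needed from it. -/
theorem bd2_star2 (F : Plaq N → K) (x : Site N) :
    bd2 (star2 F) (x, 0) = d2 F (x + unitVec N 0, ⟨(1, 2, 3), by decide⟩) ∧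
    bd2 (star2 F) (x, 1) = -d2 F (x + unitVec N 1, ⟨(0, 2, 3), by decide⟩) ∧
    bd2 (star2 F) (x, 2) = d2 F (x + unitVec N 2, ⟨(0, 1, 3), by decide⟩) ∧
    bd2 (star2 F) (x, 3) = -d2 F (x + unitVec N 3, ⟨(0, 1, 2), by decide⟩) := by
  have h (μ ν : Fin 4) (x : Site N) :
      x - unitVec N μ + unitVec N ν = x + unitVec N ν - unitVec N μ := sub_add_eq_add_sub _ _ _
  have hc (μ ν : Fin 4) (x : Site N) :
      x + unitVec N μ + unitVec N ν = x + unitVec N ν + unitVec N μ := add_right_comm _ _ _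
  refine ⟨?_, ?_, ?_, ?_⟩
  all_goals
    simp [bd2, comp2, Fin.sum_univ_four, star2_apply, d2, h, hc 1 0, hc 2 0, hc 3 0, hc 2 1,
      hc 3 1, hc 3 2]
    try ring

theorem bd2_star2_eq_zero_iff (F : Plaq N → K) : bd2 (star2 F) = 0 ↔ d2 F = 0 := by
  constructor
  · intro h
    funext ⟨x, p⟩
    have h' (μ : Fin 4) := congrFun h (x - unitVec N μ, μ)
    have h0 := h' 0
    have h1 := h' 1
    have h2 := h' 2
    have h3 := h' 3
    simp only [bd2_star2, sub_add_cancel, Pi.zero_apply, neg_eq_zero] at h0 h1 h2 h3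
    induction p using dir3_cases <;> assumption
  · intro h
    funext ⟨x, μ⟩
    obtain ⟨h0, h1, h2, h3⟩ := bd2_star2 F x
    fin_cases μ <;> simp [h0, h1, h2, h3, h]

end Star

/-! ### Summation by parts and orthogonality of `ε` -/

section Adjoint

variable {N : ℕ} [NeZero N]

theorem sum_site_shift (f g : Site N → ℝ) (μ : Fin 4) :
    ∑ x, f (x + unitVec N μ) * g x = ∑ x, f x * g (x - unitVec N μ) := by
  rw [← Equiv.sum_comp (Equiv.addRight (unitVec N μ)) fun x => f x * g (x - unitVec N μ)]
  simp

theorem d1_dotProduct (A : Link N → ℝ) (F : Plaq N → ℝ) : d1 A ⬝ᵥ F = A ⬝ᵥ bd2 F := by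
  have hs (μ ν : Fin 4) (p : Dir2) :=
    sum_site_shift (fun x => A (x, μ)) (fun x => F (x, p)) ν
  simp only [dotProduct, Fintype.sum_prod_type, sum_dir2, Fin.sum_univ_four, d1, bd2]
  simp [comp2, Finset.sum_add_distrib, Finset.sum_sub_distrib, mul_add, sub_mul,
    mul_sub, hs, Finset.sum_neg_distrib]
  ring

/-- The derivative index comes first in `d` and last in `∂`. Moving it past two indices is even, so
the sign of summation by parts survives; for 1-forms it cancels. -/
theorem d2_dotProduct (F : Plaq N → ℝ) (B : Cube N → ℝ) : d2 F ⬝ᵥ B = -(F ⬝ᵥ bd3 B) := by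
  have hs (p : Dir2) (ν : Fin 4) (q : Dir3) :=
    sum_site_shift (fun x => F (x, p)) (fun x => B (x, q)) ν
  simp only [dotProduct, Fintype.sum_prod_type, sum_dir2, sum_dir3, Fin.sum_univ_four, d2, bd3]
  simp [comp2, comp3, Finset.sum_add_distrib, Finset.sum_sub_distrib, mul_add, add_mul, sub_mul,
    mul_sub, hs, Finset.sum_neg_distrib]
  ring

theorem star2_dotProduct_star2 (F G : Plaq N → ℝ) : star2 F ⬝ᵥ star2 G = F ⬝ᵥ G := by
  have hs (μ ν : Fin 4) (p : Dir2) :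
      ∑ x, F (x + unitVec N μ + unitVec N ν, p) * G (x + unitVec N μ + unitVec N ν, p) =
      ∑ x, F (x, p) * G (x, p) := by
    rw [← Equiv.sum_comp (Equiv.addRight (unitVec N μ + unitVec N ν))
      fun x => F (x, p) * G (x, p)]
    simp [add_assoc]
  simp only [dotProduct, Fintype.sum_prod_type, sum_dir2, star2_apply, Finset.sum_add_distrib,
    neg_mul_neg, hs]
  ring

theorem epsMatrix_mulVec (F : Plaq N → ℝ) : (epsMatrix N).mulVec F = star2 F := by
  funext ⟨x, p⟩
  simp only [Matrix.mulVec, dotProduct, Fintype.sum_prod_type, epsMatrix, Matrix.of_apply, star2]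
  rw [Finset.sum_comm]
  exact Finset.sum_congr rfl fun q _ => by simp

end Adjoint

/-! ### Hodge decomposition, topological charges and the dimension of Im d -/

section Charges

variable {N : ℕ}

theorem d1_smul (r : ℝ) (A : Link N → ℝ) : d1 (r • A) = r • d1 A :=
  d1_map (AddMonoidHom.mulLeft r) A

theorem bd3_smul (r : ℝ) (B : Cube N → ℝ) : bd3 (r • B) = r • bd3 B :=
  bd3_map (AddMonoidHom.mulLeft r) B

theorem d2_smul (r : ℝ) (F : Plaq N → ℝ) : d2 (r • F) = r • d2 F :=
  d2_map (AddMonoidHom.mulLeft r) F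

theorem bd2_smul (r : ℝ) (F : Plaq N → ℝ) : bd2 (r • F) = r • bd2 F :=
  bd2_map (AddMonoidHom.mulLeft r) F

theorem star1_surjective : Surjective (star1 : (Link N → ℝ) → Cube N → ℝ) := by
  intro B
  refine ⟨fun l => (cubeSign ((cubeLink N).symm l) : ℝ) * B ((cubeLink N).symm l), ?_⟩
  funext c
  rcases cubeSign_eq c with h | h <;> simp [star1, h]

variable [NeZero N]

/-- The exterior derivative as a linear map into the Euclidean space of 2-forms. -/
def d1Lin (N : ℕ) [NeZero N] : (Link N → ℝ) →ₗ[ℝ] EuclideanSpace ℝ (Plaq N) where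
  toFun A := WithLp.toLp 2 (d1 A)
  map_add' A B := by rw [d1_add]; rfl
  map_smul' r A := by rw [d1_smul]; rfl

/-- The boundary operator as a linear map into the Euclidean space of 2-forms. -/
def bd3Lin (N : ℕ) [NeZero N] : (Cube N → ℝ) →ₗ[ℝ] EuclideanSpace ℝ (Plaq N) where
  toFun A := WithLp.toLp 2 (bd3 A)
  map_add' A B := by rw [bd3_add]; rfl
  map_smul' r A := by rw [bd3_smul]; rfl

/-- The closed 2-forms. -/
def closedForms (N : ℕ) [NeZero N] : Submodule ℝ (EuclideanSpace ℝ (Plaq N)) where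
  carrier := {F | d2 (WithLp.ofLp F) = 0}
  zero_mem' := map_zero (d2Hom N ℝ)
  add_mem' {F G} hF hG := by
    simp only [Set.mem_ofPred_eq] at hF hG ⊢
    rw [WithLp.ofLp_add, d2_add, hF, hG, add_zero]
  smul_mem' r F hF := by
    simp only [Set.mem_ofPred_eq] at hF ⊢
    rw [WithLp.ofLp_smul, d2_smul, hF, smul_zero]

theorem imD_eq_range : imD N = LinearMap.range (d1Lin N) :=
  Submodule.span_eq (LinearMap.range (d1Lin N))

theorem imBd_eq_range : imBd N = LinearMap.range (bd3Lin N) :=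
  Submodule.span_eq (LinearMap.range (bd3Lin N))

theorem mem_imD {F : EuclideanSpace ℝ (Plaq N)} :
    F ∈ imD N ↔ ∃ A : Link N → ℝ, WithLp.toLp 2 (d1 A) = F := by
  rw [imD_eq_range]; rfl

theorem mem_imBd {F : EuclideanSpace ℝ (Plaq N)} :
    F ∈ imBd N ↔ ∃ B : Cube N → ℝ, WithLp.toLp 2 (bd3 B) = F := by
  rw [imBd_eq_range]; rfl

theorem mem_harmonic {F : EuclideanSpace ℝ (Plaq N)} :
    F ∈ harmonic N ↔ d2 (WithLp.ofLp F) = 0 ∧ bd2 (WithLp.ofLp F) = 0 := by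
  refine ⟨fun h => ?_, fun h => Submodule.subset_span h⟩
  induction h using Submodule.span_induction with
  | mem x hx => exact hx
  | zero => exact ⟨map_zero (d2Hom N ℝ), by simpa using bd2_smul 0 (0 : Plaq N → ℝ)⟩
  | add x y _ _ hx hy =>
    rw [WithLp.ofLp_add, d2_add, bd2_add, hx.1, hx.2, hy.1, hy.2]
    simp
  | smul r x _ hx =>
    rw [WithLp.ofLp_smul, d2_smul, bd2_smul, hx.1, hx.2]
    simp

theorem inner_toLp (F G : Plaq N → ℝ) :
    inner ℝ (WithLp.toLp 2 F) (WithLp.toLp 2 G) = F ⬝ᵥ G := by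
  rw [EuclideanSpace.inner_eq_star_dotProduct, dotProduct_comm]
  simp

theorem dotProduct_proj (V : Submodule ℝ (EuclideanSpace ℝ (Plaq N))) (F G : Plaq N → ℝ) :
    F ⬝ᵥ proj V G = proj V F ⬝ᵥ G := by
  rw [← inner_toLp, ← inner_toLp]
  exact (V.inner_starProjection_left_eq_right _ _).symm

theorem proj_add (V : Submodule ℝ (EuclideanSpace ℝ (Plaq N))) (F G : Plaq N → ℝ) :
    proj V (F + G) = proj V F + proj V G := by
  simp [proj]

theorem proj_of_mem {V : Submodule ℝ (EuclideanSpace ℝ (Plaq N))} {F : Plaq N → ℝ}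
    (h : WithLp.toLp 2 F ∈ V) : proj V F = F := by
  simp [proj, Submodule.starProjection_eq_self_iff.2 h]

theorem proj_eq_zero {V : Submodule ℝ (EuclideanSpace ℝ (Plaq N))} {F : Plaq N → ℝ}
    (h : ∀ G : Plaq N → ℝ, WithLp.toLp 2 G ∈ V → G ⬝ᵥ F = 0) : proj V F = 0 := by
  have h1 : V.starProjection (WithLp.toLp 2 F) = 0 := by
    rw [Submodule.starProjection_apply_eq_zero_iff, Submodule.mem_orthogonal]
    intro u hu
    exact (inner_toLp _ _).trans (h _ hu)
  simp [proj, h1]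

theorem proj_imD_eq_zero {F : Plaq N → ℝ} (h : bd2 F = 0) : proj (imD N) F = 0 := by
  refine proj_eq_zero fun G hG => ?_
  obtain ⟨A, hA⟩ := mem_imD.1 hG
  obtain rfl : d1 A = G := congrArg WithLp.ofLp hA
  rw [d1_dotProduct, h, dotProduct_zero]

theorem proj_imBd_eq_zero {F : Plaq N → ℝ} (h : d2 F = 0) : proj (imBd N) F = 0 := by
  refine proj_eq_zero fun G hG => ?_
  obtain ⟨B, hB⟩ := mem_imBd.1 hG
  obtain rfl : bd3 B = G := congrArg WithLp.ofLp hB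
  rw [dotProduct_comm, ← neg_eq_zero, ← d2_dotProduct, h, zero_dotProduct]

theorem proj_harmonic_d1 (A : Link N → ℝ) : proj (harmonic N) (d1 A) = 0 := by
  refine proj_eq_zero fun G hG => ?_
  rw [dotProduct_comm, d1_dotProduct, (mem_harmonic.1 hG).2, dotProduct_zero]

theorem proj_harmonic_bd3 (B : Cube N → ℝ) : proj (harmonic N) (bd3 B) = 0 := by
  refine proj_eq_zero fun G hG => ?_
  rw [← neg_eq_zero, ← d2_dotProduct, (mem_harmonic.1 hG).1, zero_dotProduct]

/-- Removing the projection onto Im d leaves a form orthogonal to Im d, hence coclosed, and still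
closed. This remainder is harmonic, and the removed part is orthogonal to the harmonic forms. -/
theorem exists_proj_harmonic_of_closed {F : Plaq N → ℝ} (h : d2 F = 0) :
    ∃ A : Link N → ℝ, proj (harmonic N) F = F - d1 A := by
  obtain ⟨A, hA⟩ := mem_imD.1 ((imD N).starProjection_apply_mem (WithLp.toLp 2 F))
  refine ⟨A, ?_⟩
  have ho (B : Link N → ℝ) : B ⬝ᵥ bd2 (F - d1 A) = 0 := by
    rw [← d1_dotProduct, ← inner_toLp, WithLp.toLp_sub, hA]
    have := Submodule.sub_starProjection_mem_orthogonal (K := imD N) (WithLp.toLp 2 F)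
    exact (Submodule.mem_orthogonal _ _).1 this _ (mem_imD.2 ⟨B, rfl⟩)
  have hm : WithLp.toLp 2 (F - d1 A) ∈ harmonic N :=
    mem_harmonic.2 ⟨by simp [d2_sub, h, d2_d1], dotProduct_eq_zero _ fun B => by
      rw [dotProduct_comm]; exact ho B⟩
  have h2 := proj_add (harmonic N) (F - d1 A) (d1 A)
  rwa [proj_harmonic_d1, proj_of_mem hm, add_zero, sub_add_cancel] at h2

theorem exists_proj_harmonic_of_coclosed {F : Plaq N → ℝ} (h : bd2 F = 0) :
    ∃ B : Cube N → ℝ, proj (harmonic N) F = F - bd3 B := by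
  obtain ⟨A, hA⟩ := mem_imBd.1 ((imBd N).starProjection_apply_mem (WithLp.toLp 2 F))
  refine ⟨A, ?_⟩
  have ho (B : Cube N → ℝ) : d2 (F - bd3 A) ⬝ᵥ B = 0 := by
    rw [d2_dotProduct, dotProduct_comm, ← inner_toLp, WithLp.toLp_sub, hA, neg_eq_zero]
    have := Submodule.sub_starProjection_mem_orthogonal (K := imBd N) (WithLp.toLp 2 F)
    exact (Submodule.mem_orthogonal _ _).1 this _ (mem_imBd.2 ⟨B, rfl⟩)
  have hb : bd2 (F - bd3 A) = 0 := by
    have h3 := bd2_add (F - bd3 A) (bd3 A)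
    rwa [sub_add_cancel, h, bd2_bd3, add_zero, eq_comm] at h3
  have hm : WithLp.toLp 2 (F - bd3 A) ∈ harmonic N :=
    mem_harmonic.2 ⟨dotProduct_eq_zero _ ho, hb⟩
  have h2 := proj_add (harmonic N) (F - bd3 A) (bd3 A)
  rwa [proj_harmonic_bd3, proj_of_mem hm, add_zero, sub_add_cancel] at h2

/-- Each mixed term pairs the exact part of `F` with its co-exact part, so it vanishes when either
does; in the harmonic term `E` and its transpose have the same quadratic form. -/
theorem chargeNL_eq (E : Matrix (Plaq N) (Plaq N) ℝ) {F : Plaq N → ℝ}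
    (h : proj (imD N) F = 0 ∨ proj (imBd N) F = 0) :
    chargeNL E F = 1 / (8 * Real.pi ^ 2) *
      (proj (harmonic N) F ⬝ᵥ E.mulVec (proj (harmonic N) F)) := by
  have ht (v : Plaq N → ℝ) : v ⬝ᵥ E.transpose.mulVec v = v ⬝ᵥ E.mulVec v := by
    rw [Matrix.mulVec_transpose, dotProduct_comm, Matrix.dotProduct_mulVec]
  rw [chargeNL, dotProduct_add, dotProduct_add, dotProduct_proj, dotProduct_proj, dotProduct_proj,
    Matrix.smul_mulVec, Matrix.add_mulVec, dotProduct_smul, dotProduct_add, ht]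
  rcases h with h | h <;>
  · rw [h]
    simp only [zero_dotProduct, Matrix.mulVec_zero, dotProduct_zero, smul_eq_mul]
    ring

theorem d1_dotProduct_star2 (A : Link N → ℝ) {F : Plaq N → ℝ} (h : d2 F = 0) :
    d1 A ⬝ᵥ star2 F = 0 := by
  rw [d1_dotProduct, (bd2_star2_eq_zero_iff F).2 h, dotProduct_zero]

theorem dotProduct_star2_d1 (A : Link N → ℝ) {F : Plaq N → ℝ} (h : d2 F = 0) :
    F ⬝ᵥ star2 (d1 A) = 0 := by
  rw [← bd3_star1, ← neg_eq_zero, ← d2_dotProduct, h, zero_dotProduct]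

/-- Topological invariance of the charge: `ε` sends closed forms to coclosed ones, orthogonal to Im
d, and exact forms to boundaries, orthogonal to closed forms. All terms containing `dA` vanish. -/
theorem star2_quadratic_add_d1 (A : Link N → ℝ) {F : Plaq N → ℝ} (h : d2 F = 0) :
    (d1 A + F) ⬝ᵥ star2 (d1 A + F) = F ⬝ᵥ star2 F := by
  simp [star2_add, d1_dotProduct_star2, dotProduct_star2_d1, h, d2_d1]

theorem star2_quadratic_sub_d1 (A : Link N → ℝ) {F : Plaq N → ℝ} (h : d2 F = 0) :
    (F - d1 A) ⬝ᵥ star2 (F - d1 A) = F ⬝ᵥ star2 F := by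
  rw [← star2_quadratic_add_d1 A (F := F - d1 A) (by simp [d2_sub, h, d2_d1]), add_sub_cancel]

theorem Q0_eq (F : Plaq N → ℝ) : Q0 F = 1 / (8 * Real.pi ^ 2) * (F ⬝ᵥ star2 F) := by
  rw [Q0, epsMatrix_mulVec]

theorem QNL_of_closed {F : Plaq N → ℝ} (h : d2 F = 0) : QNL F = Q0 F := by
  obtain ⟨A, hA⟩ := exists_proj_harmonic_of_closed h
  rw [QNL, chargeNL_eq _ (Or.inr (proj_imBd_eq_zero h)), hA, epsMatrix_mulVec,
    star2_quadratic_sub_d1 A h, Q0_eq]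

theorem QNLdual_of_closed {F : Plaq N → ℝ} (h : d2 F = 0) : QNLdual F = Q0 F := by
  obtain ⟨A, hA⟩ := exists_proj_harmonic_of_closed h
  rw [QNLdual, chargeNL_eq _ (Or.inr (proj_imBd_eq_zero h)), hA, Matrix.mulVec_transpose,
    dotProduct_comm, ← Matrix.dotProduct_mulVec, epsMatrix_mulVec, star2_quadratic_sub_d1 A h,
    Q0_eq]

/-- The harmonic part of `ε F` is `ε` of the harmonic part of `F`, and `ε`, being orthogonal,
preserves its own quadratic form. -/
theorem QNL_star2_of_closed {F : Plaq N → ℝ} (h : d2 F = 0) : QNL (star2 F) = Q0 F := by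
  have hb := (bd2_star2_eq_zero_iff F).2 h
  obtain ⟨B, hB⟩ := exists_proj_harmonic_of_coclosed hb
  obtain ⟨A, rfl⟩ := star1_surjective B
  have h1 : star2 F - bd3 (star1 A) = star2 (F - d1 A) := by
    rw [bd3_star1, sub_eq_iff_eq_add, ← star2_add, sub_add_cancel]
  rw [QNL, chargeNL_eq _ (Or.inl (proj_imD_eq_zero hb)), hB, epsMatrix_mulVec, h1,
    star2_dotProduct_star2, star2_quadratic_sub_d1 A h, Q0_eq]

/-- `star2` is injective and carries Im d onto Im ∂, since every 3-form is the `star1` of a 1-form.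
-/
theorem finrank_imBd : Module.finrank ℝ (imBd N) = Module.finrank ℝ (imD N) := by
  let S : EuclideanSpace ℝ (Plaq N) →ₗ[ℝ] EuclideanSpace ℝ (Plaq N) :=
    { toFun := fun F => WithLp.toLp 2 (star2 (WithLp.ofLp F))
      map_add' := fun F G => by rw [WithLp.ofLp_add, star2_add]; rfl
      map_smul' := fun r F => by rw [WithLp.ofLp_smul, star2_smul]; rfl }
  have hS : Injective S := fun F G h =>
    WithLp.ofLp_injective 2 (star2_bijective.1 (congrArg WithLp.ofLp h))
  have hm : imBd N = (imD N).map S := by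
    ext F
    rw [mem_imBd, Submodule.mem_map]
    constructor
    · rintro ⟨B, rfl⟩
      obtain ⟨A, rfl⟩ := star1_surjective B
      exact ⟨_, mem_imD.2 ⟨A, rfl⟩, by rw [bd3_star1]; rfl⟩
    · rintro ⟨_, hG, rfl⟩
      obtain ⟨A, rfl⟩ := mem_imD.1 hG
      exact ⟨star1 A, by rw [bd3_star1]; rfl⟩
  rw [hm]
  exact (LinearEquiv.finrank_eq (Submodule.equivMapOfInjective S hS (imD N))).symm

theorem finrank_closedForms :
    Module.finrank ℝ (closedForms N) = Module.finrank ℝ (imD N) + 6 := by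
  let T : (imD N × (Dir2 → ℝ)) →ₗ[ℝ] EuclideanSpace ℝ (Plaq N) :=
    { toFun := fun q => q.1.1 + WithLp.toLp 2 (fluxForm N q.2)
      map_add' := fun q r => by
        ext c
        simp only [fluxForm, Prod.fst_add, Prod.snd_add, Submodule.coe_add, PiLp.add_apply,
          Pi.add_apply]
        split_ifs <;> ring
      map_smul' := fun r q => by
        ext c
        simp [fluxForm] }
  have hT : Injective T := by
    rw [← LinearMap.ker_eq_bot, LinearMap.ker_eq_bot']
    rintro ⟨⟨F, hF⟩, c⟩ h
    obtain ⟨A, rfl⟩ := mem_imD.1 hF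
    have h1 : d1 A + fluxForm N c = 0 := congrArg WithLp.ofLp h
    have h2 := congrArg period h1
    rw [period_add, period_d1, period_fluxForm, zero_add] at h2
    obtain rfl : c = 0 := h2.trans (by funext p; simp [period])
    have h3 : fluxForm N (0 : Dir2 → ℝ) = 0 := by funext c; simp [fluxForm]
    rw [h3, add_zero] at h1
    simp [h1]
  have hr : LinearMap.range T = closedForms N := by
    ext F
    constructor
    · rintro ⟨⟨⟨F, hF⟩, c⟩, rfl⟩
      obtain ⟨A, rfl⟩ := mem_imD.1 hF
      change d2 (d1 A + fluxForm N c) = 0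
      rw [d2_add, d2_d1, d2_fluxForm, add_zero]
    · intro h
      obtain ⟨A, hA⟩ := exists_eq_d1_add_fluxForm (F := WithLp.ofLp F) h
      exact ⟨(⟨_, mem_imD.2 ⟨A, rfl⟩⟩, period (WithLp.ofLp F)),
        WithLp.ofLp_injective 2 hA.symm⟩
  rw [← hr, LinearMap.finrank_range_of_inj hT, Module.finrank_prod]
  simp
  decide

theorem orthogonal_imBd : (imBd N)ᗮ = closedForms N := by
  ext F
  rw [Submodule.mem_orthogonal]
  constructor
  · intro h
    refine dotProduct_eq_zero _ fun B => ?_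
    rw [d2_dotProduct, dotProduct_comm, neg_eq_zero, ← inner_toLp]
    exact h _ (mem_imBd.2 ⟨B, rfl⟩)
  · intro h G hG
    obtain ⟨B, rfl⟩ := mem_imBd.1 hG
    refine (inner_toLp _ (WithLp.ofLp F)).trans ?_
    rw [dotProduct_comm, ← neg_eq_zero, ← d2_dotProduct]
    change d2 _ = 0 at h
    rw [h, zero_dotProduct]

/-- The closed forms are the orthogonal complement of Im ∂, so the 6N⁴ plaquettes count dim Im ∂ +
(dim Im d + 6) = 2 dim Im d + 6. -/
theorem finrank_imD : Module.finrank ℝ (imD N) = 3 * (N ^ 4 - 1) := by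
  have h := (imBd N).finrank_add_finrank_orthogonal
  rw [orthogonal_imBd, finrank_closedForms, finrank_imBd, finrank_euclideanSpace] at h
  have hc : Fintype.card (Plaq N) = N ^ 4 * 6 := by
    rw [Fintype.card_prod, Fintype.card_fun, ZMod.card, Fintype.card_fin]
    congr 1
  have hN : 1 ≤ N ^ 4 := Nat.one_le_pow _ _ (NeZero.pos N)
  omega

end Charges

/-! ### The box measure: Fourier orthogonality, reflections and periodic shifts -/

section Box

/-- The lattice of gauge shifts by multiples of `2π`. -/
def shiftLattice (ι : Type) : AddSubgroup (ι → ℝ) :=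
  (AddMonoidHom.mk' (fun (m : ι → ℤ) (i : ι) => 2 * Real.pi * (m i : ℝ))
    fun m n => by funext i; simp [mul_add]).range

theorem mem_shiftLattice {ι : Type} {A : ι → ℝ} :
    A ∈ shiftLattice ι ↔ ∃ m : ι → ℤ, (fun i => 2 * Real.pi * (m i : ℝ)) = A := Iff.rfl

/-- The uniform probability measure on `[-π, π)`. -/
def angleMeasure : Measure ℝ :=
  ENNReal.ofReal (2 * Real.pi)⁻¹ • volume.restrict (Set.Ico (-Real.pi) Real.pi)

instance : IsProbabilityMeasure angleMeasure := by
  constructor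
  rw [angleMeasure, Measure.smul_apply, Measure.restrict_apply_univ, Real.volume_Ico, smul_eq_mul,
    ← ENNReal.ofReal_mul (by positivity), sub_neg_eq_add, ← two_mul,
    inv_mul_cancel₀ (by positivity), ENNReal.ofReal_one]

variable {ι κ : Type} [Fintype ι] [Fintype κ]

theorem boxMeasure_eq_pi : boxMeasure ι = Measure.pi fun _ : ι => angleMeasure := by
  refine (Measure.pi_eq fun s hs => ?_).symm
  rw [boxMeasure, Measure.smul_apply, volume_pi, Measure.restrict_pi_pi, Measure.pi_pi]
  simp only [angleMeasure, Measure.smul_apply, smul_eq_mul, Finset.prod_mul_distrib,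
    Finset.prod_const, Finset.card_univ]
  rw [ENNReal.ofReal_pow (by positivity)]

instance : IsProbabilityMeasure (boxMeasure ι) := by
  rw [boxMeasure_eq_pi]; infer_instance

theorem integral_angle_exp (k : ℤ) :
    ∫ x, Complex.exp (Complex.I * ((x * k : ℝ) : ℂ)) ∂angleMeasure = if k = 0 then 1 else 0 := by
  split_ifs with hk
  · simp [hk]
  rw [angleMeasure, integral_smul_measure, ← integral_Icc_eq_integral_Ico,
    integral_Icc_eq_integral_Ioc, ← intervalIntegral.integral_of_le (by linarith [Real.pi_pos])]
  have hc : Complex.I * k ≠ 0 := by simp [hk]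
  have h (x : ℝ) : Complex.exp (Complex.I * ((x * k : ℝ) : ℂ)) =
      Complex.exp (Complex.I * k * x) := by push_cast; ring_nf
  simp only [h]
  rw [integral_exp_mul_complex hc]
  have h1 : Complex.exp (Complex.I * k * (Real.pi : ℝ)) =
      Complex.exp (Complex.I * k * ((-Real.pi : ℝ) : ℂ)) :=
    Complex.exp_eq_exp_iff_exists_int.2 ⟨k, by push_cast; ring⟩
  rw [h1, sub_self, zero_div, smul_zero]

theorem integral_box_exp (k : ι → ℤ) :
    ∫ b, Complex.exp (Complex.I * ((b ⬝ᵥ (fun i => (k i : ℝ)) : ℝ) : ℂ)) ∂boxMeasure ι =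
      if k = 0 then 1 else 0 := by
  have h (b : ι → ℝ) : Complex.exp (Complex.I * ((b ⬝ᵥ (fun i => (k i : ℝ)) : ℝ) : ℂ)) =
      ∏ i, Complex.exp (Complex.I * ((b i * k i : ℝ) : ℂ)) := by
    rw [← Complex.exp_sum, ← Finset.mul_sum, dotProduct]
    push_cast
    rfl
  simp only [h]
  rw [boxMeasure_eq_pi, integral_fintype_prod_eq_prod
    (f := fun i x => Complex.exp (Complex.I * ((x * k i : ℝ) : ℂ)))]
  simp only [integral_angle_exp]
  split_ifs with hk
  · simp [hk]
  · obtain ⟨i, hi⟩ := Function.ne_iff.1 hk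
    exact Finset.prod_eq_zero (Finset.mem_univ i) (by simpa using hi)

theorem measurePreserving_neg_angle :
    MeasurePreserving (fun x : ℝ => -x) angleMeasure angleMeasure := by
  -- The half-open interval is not symmetric, but up to a null set it is the closed one, which is.
  have h : angleMeasure =
      ENNReal.ofReal (2 * Real.pi)⁻¹ • volume.restrict (Set.Icc (-Real.pi) Real.pi) := by
    rw [angleMeasure, Measure.restrict_congr_set Ico_ae_eq_Icc]
  rw [h]
  have h1 := (Measure.measurePreserving_neg (volume : Measure ℝ)).restrict_preimage
    (s := Set.Icc (-Real.pi) Real.pi) measurableSet_Icc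
  have h2 : Neg.neg ⁻¹' Set.Icc (-Real.pi) Real.pi = Set.Icc (-Real.pi) Real.pi := by
    simp
  rw [h2] at h1
  exact h1.smul_measure _

theorem measurePreserving_signed_perm (e : κ ≃ ι) (s : κ → ℤ) (hs : ∀ c, s c = 1 ∨ s c = -1) :
    MeasurePreserving (fun (A : ι → ℝ) (c : κ) => (s c : ℝ) * A (e c))
      (boxMeasure ι) (boxMeasure κ) := by
  rw [boxMeasure_eq_pi, boxMeasure_eq_pi]
  have h1 : MeasurePreserving (fun (A : ι → ℝ) (c : κ) => A (e c))
      (Measure.pi fun _ : ι => angleMeasure) (Measure.pi fun _ : κ => angleMeasure) :=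
    (measurePreserving_piCongrLeft (fun _ : ι => angleMeasure) e).symm
  have h2 : MeasurePreserving (fun (A : κ → ℝ) (c : κ) => (s c : ℝ) * A c)
      (Measure.pi fun _ : κ => angleMeasure) (Measure.pi fun _ : κ => angleMeasure) := by
    refine measurePreserving_pi _ _ fun c => ?_
    rcases hs c with h | h
    · have e : (HMul.hMul (s c : ℝ)) = (id : ℝ → ℝ) := by funext x; simp [h]
      rw [e]
      exact MeasurePreserving.id angleMeasure
    · have e : (HMul.hMul (s c : ℝ)) = fun x : ℝ => -x := by funext x; simp [h]
      rw [e]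
      exact measurePreserving_neg_angle
  exact h2.comp h1

theorem isAddFundamentalDomain_box (a : ι → ℝ) :
    IsAddFundamentalDomain (shiftLattice ι)
      (Set.univ.pi fun i => Set.Ico (a i) (a i + 2 * Real.pi)) volume := by
  refine IsAddFundamentalDomain.mk'
    (MeasurableSet.univ_pi fun i => measurableSet_Ico).nullMeasurableSet fun x => ?_
  choose m hm hu using fun i => existsUnique_add_zsmul_mem_Ico Real.two_pi_pos (x i) (a i)
  refine ⟨⟨_, mem_shiftLattice.2 ⟨m, rfl⟩⟩, ?_, ?_⟩
  · intro i _
    have := hm i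
    simpa [AddSubgroup.vadd_def, add_comm, mul_comm] using this
  · rintro ⟨_, k, rfl⟩ hk
    have : k = m := by
      funext i
      refine hu i _ ?_
      have := hk i (Set.mem_univ i)
      simpa [AddSubgroup.vadd_def, add_comm, mul_comm] using this
    subst this
    rfl

/-- The box and its translate are both fundamental domains of the lattice `2πℤ^ι`, so a periodic
function has the same integral over each. -/
theorem lintegral_box_shift {f : (ι → ℝ) → ENNReal}
    (hf : ∀ (m : ι → ℤ) (A : ι → ℝ), f ((fun i => 2 * Real.pi * (m i : ℝ)) + A) = f A)
    (B : ι → ℝ) : ∫⁻ A, f (A + B) ∂boxMeasure ι = ∫⁻ A, f A ∂boxMeasure ι := by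
  have : Countable (shiftLattice ι) := (Set.countable_range _).to_subtype
  simp only [boxMeasure, lintegral_smul_measure]
  congr 1
  have h0 := isAddFundamentalDomain_box (fun _ : ι => -Real.pi)
  have h1 := isAddFundamentalDomain_box (fun i : ι => -Real.pi + B i)
  have hπ : -Real.pi + 2 * Real.pi = Real.pi := by ring
  simp only [hπ] at h0
  have h2 := h1.setLIntegral_eq h0 f (by
    rintro ⟨_, k, rfl⟩ A
    exact hf k A)
  rw [← h2]
  have h3 := (measurePreserving_add_right (volume : Measure (ι → ℝ)) B).setLIntegral_comp_preimage_emb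
    (measurableEmbedding_addRight B) f
    (Set.univ.pi fun i => Set.Ico (-Real.pi + B i) (-Real.pi + B i + 2 * Real.pi))
  rw [← h3]
  congr 2
  ext A
  simp only [Set.mem_pi, Set.mem_preimage, Set.mem_Ico, Pi.add_apply, Set.mem_univ, true_imp_iff]
  refine forall_congr' fun i => and_congr (by simp) ?_
  constructor <;> intro h <;> linarith

end Box

/-! ### Sums of products and Gaussian sums -/

section Sums

/-- Sums over families become integrals over a product measure, so that Fubini for finite products
applies to them. -/
theorem pi_count_eq {ι α : Type} [Fintype ι] [Countable α] [MeasurableSpace α]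
    [MeasurableSingletonClass α] :
    Measure.pi (fun _ : ι => (Measure.count : Measure α)) = Measure.count := by
  refine Measure.ext_of_singleton fun f => ?_
  rw [Measure.pi_singleton]
  simp

theorem summable_prod_pi {ι α : Type} [Fintype ι] [Countable α] {f : ι → α → ℂ}
    (hf : ∀ i, Summable (f i)) : Summable fun n : ι → α => ∏ i, f i (n i) := by
  let _ : MeasurableSpace α := ⊤
  have : MeasurableSingletonClass α := ⟨fun _ => trivial⟩
  have h := Integrable.fintype_prod (μ := fun _ : ι => (Measure.count : Measure α))
    (f := f) fun i => integrable_count_iff.2 (hf i).norm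
  rw [pi_count_eq, integrable_count_iff] at h
  exact h.of_norm

theorem tsum_prod_pi {ι α : Type} [Fintype ι] [Countable α] {f : ι → α → ℂ}
    (hf : ∀ i, Summable (f i)) : ∑' n : ι → α, ∏ i, f i (n i) = ∏ i, ∑' a, f i a := by
  let _ : MeasurableSpace α := ⊤
  have : MeasurableSingletonClass α := ⟨fun _ => trivial⟩
  have h := integral_fintype_prod_eq_prod (μ := fun _ : ι => (Measure.count : Measure α)) f
  have h1 (i : ι) : ∫ a, f i a ∂Measure.count = ∑' a, f i a := by
    rw [integral_countable (integrable_count_iff.2 (hf i).norm)]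
    simp [Measure.real]
  rw [pi_count_eq, integral_countable (integrable_count_iff.2 (summable_prod_pi hf).norm)] at h
  simpa [Measure.real, h1] using h

theorem summable_gaussian_int {c : ℝ} (hc : 0 < c) :
    Summable fun n : ℤ => Real.exp (-(c * (n : ℝ) ^ 2)) := by
  have h := (summable_jacobiTheta₂_term_iff 0 (Complex.I * (c / Real.pi : ℝ))).2 (by
    rw [mul_comm, Complex.im_ofReal_mul, Complex.I_im, mul_one]
    exact div_pos hc Real.pi_pos)
  refine h.norm.congr fun n => ?_
  have h2 : 2 * (Real.pi : ℂ) * Complex.I * n * 0 +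
      Real.pi * Complex.I * (n : ℂ) ^ 2 * (Complex.I * (c / Real.pi : ℝ)) =
      ((-(c * (n : ℝ) ^ 2) : ℝ) : ℂ) := by
    have : (Real.pi : ℂ) ≠ 0 := by exact_mod_cast Real.pi_ne_zero
    push_cast
    field_simp
    linear_combination (n : ℂ) ^ 2 * c * Complex.I_sq
  rw [jacobiTheta₂_term, h2, Complex.norm_exp, Complex.ofReal_re]

theorem summable_gaussian_pi {ι : Type} [Fintype ι] {c : ℝ} (hc : 0 < c) :
    Summable fun n : ι → ℤ => Real.exp (-(c * ∑ i, (n i : ℝ) ^ 2)) := by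
  have h := summable_prod_pi (ι := ι) (f := fun _ (n : ℤ) =>
    ((Real.exp (-(c * (n : ℝ) ^ 2)) : ℝ) : ℂ))
    fun _ => Complex.summable_ofReal.2 (summable_gaussian_int hc)
  refine h.norm.congr fun n => ?_
  rw [← Complex.ofReal_prod, Complex.norm_real, ← Real.exp_sum, Real.norm_eq_abs, Real.abs_exp,
    Finset.sum_neg_distrib, Finset.mul_sum]

end Sums

/-! ### Convergence of the path integrals and elimination of the phase fields -/

section PathIntegrals

theorem d2_fieldE {N : ℕ} (A : Link N → ℝ) (n : Plaq N → ℤ) :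
    d2 (fieldE A n) = fun c => 2 * Real.pi * ((d2 n c : ℤ) : ℝ) := by
  have h : fieldE A n = d1 A + fun c =>
    ((AddMonoidHom.mulLeft (2 * Real.pi)).comp (Int.castAddHom ℝ)) (n c) := rfl
  rw [h, d2_add, d2_d1, zero_add, d2_map]
  rfl

theorem bd2_fieldM {N : ℕ} (B : Cube N → ℝ) (m : Plaq N → ℤ) :
    bd2 (fieldM B m) = fun c => 2 * Real.pi * ((bd2 m c : ℤ) : ℝ) := by
  have h : fieldM B m = bd3 B + fun c =>
    ((AddMonoidHom.mulLeft (2 * Real.pi)).comp (Int.castAddHom ℝ)) (m c) := rfl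
  rw [h, bd2_add, bd2_bd3, zero_add, bd2_map]
  rfl

theorem star2_fieldE {N : ℕ} (A : Link N → ℝ) (n : Plaq N → ℤ) :
    fieldM (star1 A) (star2 n) = star2 (fieldE A n) := by
  have h : fieldE A n = d1 A + (2 * Real.pi) • fun c => (n c : ℝ) := rfl
  rw [h, star2_add, star2_smul, star2_intCast, ← bd3_star1]
  rfl

theorem hasSum_subtype_of_mul_ite {ι : Type} {P : ι → Prop} [DecidablePred P] {f : ι → ℂ} {z : ℂ}
    (h : HasSum (fun n => f n * if P n then 1 else 0) z) :
    HasSum (fun n : {n // P n} => f n.1) z := by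
  have h1 := (hasSum_subtype_iff_of_support_subset (s := {n | P n}) (fun n hn => by
    by_contra hP
    exact hn (by simp [show ¬ P n from hP]))).2 h
  have h2 : (fun n => f n * if P n then 1 else 0) ∘ ((↑) : {n | P n} → ι) =
      fun n : {n // P n} => f n.1 := by
    funext n
    have hn : P n.1 := n.2
    simp [hn]
  rwa [h2] at h1

/-- A bound that factors into an integrable function of the continuous field and a summable function
of the discrete one gives convergence and the exchange of sum and integral at once. -/
theorem pathConvergent_hasSum {X ι : Type} [MeasurableSpace X] [Countable ι] {μ : Measure X}
    {w : X → ι → ℂ} {M : X → ℝ} {u : ι → ℝ}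
    (hw : ∀ n, AEStronglyMeasurable (fun a => w a n) μ) (hM : Integrable M μ) (hu : Summable u)
    (hb : ∀ a n, ‖w a n‖ ≤ M a * u n) :
    PathConvergent μ w ∧ HasSum (fun n => ∫ a, w a n ∂μ) (pathIntegral μ w) := by
  have hs (a : X) : Summable (w a) := Summable.of_norm_bounded (hu.mul_left (M a)) (hb a)
  have hi (n : ι) : Integrable (fun a => w a n) μ :=
    Integrable.mono' (hM.mul_const (u n)) (hw n) (Filter.Eventually.of_forall fun a => hb a n)
  refine ⟨⟨hs, ?_⟩, ?_⟩
  · refine Integrable.mono' (hM.mul_const (∑' n, u n)) ?_ (Filter.Eventually.of_forall fun a => ?_)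
    · refine aestronglyMeasurable_of_tendsto_ae (u := Filter.atTop)
        (f := fun (s : Finset ι) a => ∑ n ∈ s, w a n) ?_ ?_
      · intro s
        exact Finset.aestronglyMeasurable_fun_sum s fun n _ => hw n
      · exact Filter.Eventually.of_forall fun a => (hs a).hasSum
    · rw [← tsum_mul_left]
      exact tsum_of_norm_bounded ((hu.mul_left (M a)).hasSum) (hb a)
  · refine hasSum_integral_of_summable_integral_norm hi ?_
    refine Summable.of_nonneg_of_le (fun n => integral_nonneg fun a => norm_nonneg _) (fun n => ?_)
      (hu.mul_left (∫ a, M a ∂μ))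
    rw [← integral_mul_const]
    exact integral_mono (hi n).norm (hM.mul_const (u n)) fun a => hb a n

theorem integrable_box {ι : Type} [Fintype ι] {f : (ι → ℝ) → ℝ} (hf : Continuous f) :
    Integrable f (boxMeasure ι) := by
  refine Integrable.smul_measure ?_ ENNReal.ofReal_ne_top
  have h : IntegrableOn f (Set.univ.pi fun _ : ι => Set.Icc (-Real.pi) Real.pi) volume :=
    hf.continuousOn.integrableOn_compact (isCompact_univ_pi fun _ => isCompact_Icc)
  exact h.mono_set (Set.pi_mono fun _ _ => Set.Ico_subset_Icc_self)

variable {N : ℕ} [NeZero N]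

theorem continuous_d1 : Continuous (d1 : (Link N → ℝ) → Plaq N → ℝ) :=
  (PiLp.continuous_ofLp 2 _).comp (d1Lin N).continuous_of_finiteDimensional

theorem continuous_bd3 : Continuous (bd3 : (Cube N → ℝ) → Plaq N → ℝ) :=
  (PiLp.continuous_ofLp 2 _).comp (bd3Lin N).continuous_of_finiteDimensional

theorem continuous_proj (V : Submodule ℝ (EuclideanSpace ℝ (Plaq N))) :
    Continuous (proj V) :=
  (PiLp.continuous_ofLp 2 _).comp (V.starProjection.continuous.comp (PiLp.continuous_toLp 2 _))

theorem continuous_chargeNL (E : Matrix (Plaq N) (Plaq N) ℝ) : Continuous (chargeNL E) := by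
  have h (V : Submodule ℝ (EuclideanSpace ℝ (Plaq N))) := continuous_proj V
  have hm (E : Matrix (Plaq N) (Plaq N) ℝ) {f : (Plaq N → ℝ) → Plaq N → ℝ} (hf : Continuous f) :
      Continuous fun F => E.mulVec (f F) := continuous_const.matrix_mulVec hf
  refine continuous_const.mul (continuous_id.dotProduct ?_)
  exact (((h _).comp (hm _ (h _))).add ((h _).comp (hm _ (h _)))).add ((h _).comp (hm _ (h _)))

theorem continuous_Q0 : Continuous (Q0 : (Plaq N → ℝ) → ℝ) :=
  continuous_const.mul (continuous_id.dotProduct (continuous_const.matrix_mulVec continuous_id))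

theorem continuous_boltzmann {Q : (Plaq N → ℝ) → ℝ} (hQ : Continuous Q) (β θ : ℝ) :
    Continuous (boltzmann Q β θ) := by
  have h : Continuous fun F : Plaq N → ℝ => F ⬝ᵥ F := continuous_id.dotProduct continuous_id
  unfold boltzmann
  fun_prop

theorem norm_boltzmann (Q : (Plaq N → ℝ) → ℝ) (β θ : ℝ) (F : Plaq N → ℝ) :
    ‖boltzmann Q β θ F‖ = Real.exp (-(β / 2 * (F ⬝ᵥ F))) := by
  rw [boltzmann, Complex.norm_exp]
  congr 1
  rw [mul_comm Complex.I]
  simp only [Complex.sub_re, Complex.neg_re, Complex.ofReal_re, Complex.re_ofReal_mul,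
    Complex.I_re, mul_zero, sub_zero]

/-- The norm of a Boltzmann weight is dominated by a product of a function of the continuous field
and a summable function of the discrete field. -/
theorem norm_boltzmann_le (Q : (Plaq N → ℝ) → ℝ) {β : ℝ} (hβ : 0 < β) (θ : ℝ) (y : Plaq N → ℝ)
    (n : Plaq N → ℤ) :
    ‖boltzmann Q β θ fun c => y c + 2 * Real.pi * (n c : ℝ)‖ ≤
      Real.exp (β / 2 * (y ⬝ᵥ y)) *
        Real.exp (-(β * Real.pi ^ 2 * ∑ c, (n c : ℝ) ^ 2)) := by
  rw [norm_boltzmann, ← Real.exp_add, Real.exp_le_exp, dotProduct, dotProduct, Finset.mul_sum,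
    Finset.mul_sum, Finset.mul_sum, ← Finset.sum_neg_distrib, ← Finset.sum_neg_distrib,
    ← Finset.sum_add_distrib]
  refine Finset.sum_le_sum fun c _ => ?_
  -- The identity behind this is `(y + 2πn)² + y² - 2π²n² = 2(y + πn)²`.
  nlinarith [mul_nonneg hβ.le (sq_nonneg (y c + Real.pi * (n c : ℝ)))]

theorem continuous_fieldE (n : Plaq N → ℤ) : Continuous fun A : Link N → ℝ => fieldE A n :=
  continuous_d1.add continuous_const

theorem continuous_fieldM (n : Plaq N → ℤ) : Continuous fun B : Cube N → ℝ => fieldM B n :=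
  continuous_bd3.add continuous_const

theorem weight_hasSum {β : ℝ} (hβ : 0 < β) (θ : ℝ) :
    PathConvergent (boxMeasure (Link N)) (weight β θ) ∧
      HasSum (fun n : ClosedForm N => ∫ A, boltzmann Q0 β θ (fieldE A n.1) ∂boxMeasure (Link N))
        (Z N β θ) := by
  have hc : 0 < β * Real.pi ^ 2 := by positivity
  refine pathConvergent_hasSum (w := weight β θ) (M := fun A => Real.exp (β / 2 * (d1 A ⬝ᵥ d1 A)))
    (u := fun n : ClosedForm N => Real.exp (-(β * Real.pi ^ 2 * ∑ c, (n.1 c : ℝ) ^ 2)))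
    (fun n => ?_) ?_ ?_ fun A n => ?_
  · exact ((continuous_boltzmann continuous_Q0 β θ).comp
      (continuous_fieldE n.1)).aestronglyMeasurable
  · have h : Continuous fun A : Link N → ℝ => d1 A ⬝ᵥ d1 A := continuous_d1.dotProduct continuous_d1
    exact integrable_box (by fun_prop)
  · exact (summable_gaussian_pi hc).comp_injective Subtype.val_injective
  · exact norm_boltzmann_le Q0 hβ θ (d1 A) n.1

theorem integral_box_exp_neg {κ : Type} [Fintype κ] (k : κ → ℤ) :
    ∫ b, Complex.exp (-(Complex.I * ((b ⬝ᵥ (fun i => (k i : ℝ)) : ℝ) : ℂ))) ∂boxMeasure κ =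
      if k = 0 then 1 else 0 := by
  have h := integral_box_exp (-k)
  simp only [neg_eq_zero] at h
  rw [← h]
  congr 1
  funext b
  have h2 : (fun i => (((-k) i : ℤ) : ℝ)) = -fun i => (k i : ℝ) := by funext i; simp
  rw [h2, dotProduct_neg]
  push_cast
  ring_nf

theorem weightE_eq (Q : (Plaq N → ℝ) → ℝ) (β θ : ℝ) (A : Link N → ℝ) (B : Cube N → ℝ)
    (n : Plaq N → ℤ) :
    weightE Q β θ (A, B) n = boltzmann Q β θ (fieldE A n) *
      Complex.exp (-(Complex.I * ((B ⬝ᵥ (fun i => ((d2 n i : ℤ) : ℝ)) : ℝ) : ℂ))) := by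
  have h : 1 / (2 * Real.pi) * (bd3 B ⬝ᵥ fieldE A n) = -(B ⬝ᵥ (fun i => ((d2 n i : ℤ) : ℝ))) := by
    have h1 : (fun c => 2 * Real.pi * ((d2 n c : ℤ) : ℝ)) = (2 * Real.pi) • fun c => ((d2 n c : ℤ) : ℝ) := rfl
    rw [dotProduct_comm, ← neg_eq_iff_eq_neg.2 (d2_dotProduct (fieldE A n) B).symm.symm,
      d2_fieldE, h1, smul_dotProduct, dotProduct_comm B, smul_eq_mul]
    field_simp
  simp only [weightE, h]
  push_cast
  ring_nf

theorem weightM_eq (Q : (Plaq N → ℝ) → ℝ) (β θ : ℝ) (A : Link N → ℝ) (B : Cube N → ℝ)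
    (m : Plaq N → ℤ) :
    weightM Q β θ (A, B) m =
      Complex.exp (-(Complex.I * ((A ⬝ᵥ (fun i => ((bd2 m i : ℤ) : ℝ)) : ℝ) : ℂ))) *
        boltzmann Q β θ (fieldM B m) := by
  have h : 1 / (2 * Real.pi) * (fieldM B m ⬝ᵥ d1 A) = A ⬝ᵥ (fun i => ((bd2 m i : ℤ) : ℝ)) := by
    have h1 : (fun c => 2 * Real.pi * ((bd2 m c : ℤ) : ℝ)) = (2 * Real.pi) • fun c => ((bd2 m c : ℤ) : ℝ) := rfl
    rw [dotProduct_comm, d1_dotProduct, bd2_fieldM, h1, dotProduct_smul, smul_eq_mul]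
    field_simp
  simp only [weightM, h]
  rw [mul_comm]

theorem norm_exp_phase (r : ℝ) : ‖Complex.exp (-(Complex.I * (r : ℂ)))‖ = 1 := by
  rw [mul_comm, ← neg_mul, ← Complex.ofReal_neg, Complex.norm_exp_ofReal_mul_I]

/-- By summation by parts `A^m` couples only to the integer form `dn`, so it is a Lagrange
multiplier: its integral is 1 if `dn = 0` and 0 otherwise. -/
theorem weightE_hasSum {Q : (Plaq N → ℝ) → ℝ} (hQ : Continuous Q) {β : ℝ} (hβ : 0 < β) (θ : ℝ) :
    PathConvergent (boxMeasureEM N) (weightE Q β θ) ∧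
      HasSum (fun n : ClosedForm N => ∫ A, boltzmann Q β θ (fieldE A n.1) ∂boxMeasure (Link N))
        (pathIntegral (boxMeasureEM N) (weightE Q β θ)) := by
  have hc : 0 < β * Real.pi ^ 2 := by positivity
  have hw (n : Plaq N → ℤ) : (fun AB => weightE Q β θ AB n) =
      fun AB : (Link N → ℝ) × (Cube N → ℝ) => boltzmann Q β θ (fieldE AB.1 n) *
      Complex.exp (-(Complex.I * ((AB.2 ⬝ᵥ (fun i => ((d2 n i : ℤ) : ℝ)) : ℝ) : ℂ))) :=
    funext fun AB => weightE_eq Q β θ AB.1 AB.2 n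
  have hd : Continuous fun A : Link N → ℝ => d1 A ⬝ᵥ d1 A := continuous_d1.dotProduct continuous_d1
  obtain ⟨h1, h2⟩ := pathConvergent_hasSum (μ := boxMeasureEM N) (w := weightE Q β θ)
    (M := fun AB => Real.exp (β / 2 * (d1 AB.1 ⬝ᵥ d1 AB.1)))
    (u := fun n => Real.exp (-(β * Real.pi ^ 2 * ∑ c, (n c : ℝ) ^ 2)))
    (fun n => by
      rw [hw]
      have h3 : Continuous fun A : Link N → ℝ => boltzmann Q β θ (fieldE A n) :=
        (continuous_boltzmann hQ β θ).comp (continuous_fieldE n)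
      have h4 : Continuous fun B : Cube N → ℝ => B ⬝ᵥ (fun i => ((d2 n i : ℤ) : ℝ)) :=
        continuous_id.dotProduct continuous_const
      have h5 : Continuous fun B : Cube N → ℝ =>
          Complex.exp (-(Complex.I * ((B ⬝ᵥ (fun i => ((d2 n i : ℤ) : ℝ)) : ℝ) : ℂ))) := by
        fun_prop
      exact ((h3.comp continuous_fst).mul (h5.comp continuous_snd)).aestronglyMeasurable)
    ((integrable_box (f := fun A : Link N → ℝ => Real.exp (β / 2 * (d1 A ⬝ᵥ d1 A)))
      (by fun_prop)).comp_fst _)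
    (summable_gaussian_pi hc)
    (fun AB n => by
      rw [show weightE Q β θ AB n = _ from congrFun (hw n) AB, norm_mul, norm_exp_phase, mul_one]
      exact norm_boltzmann_le Q hβ θ (d1 AB.1) n)
  refine ⟨h1, ?_⟩
  simp only [hw, boxMeasureEM] at h2
  have h5 (n : Plaq N → ℤ) := integral_prod_mul (μ := boxMeasure (Link N))
    (ν := boxMeasure (Cube N)) (fun A => boltzmann Q β θ (fieldE A n))
    (fun B => Complex.exp (-(Complex.I * ((B ⬝ᵥ (fun i => ((d2 n i : ℤ) : ℝ)) : ℝ) : ℂ))))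
  simp only [h5, integral_box_exp_neg] at h2
  exact hasSum_subtype_of_mul_ite h2

theorem weightM_hasSum {Q : (Plaq N → ℝ) → ℝ} (hQ : Continuous Q) {β : ℝ} (hβ : 0 < β) (θ : ℝ) :
    PathConvergent (boxMeasureEM N) (weightM Q β θ) ∧
      HasSum (fun m : {m : Plaq N → ℤ // bd2 m = 0} =>
          ∫ B, boltzmann Q β θ (fieldM B m.1) ∂boxMeasure (Cube N))
        (pathIntegral (boxMeasureEM N) (weightM Q β θ)) := by
  have hc : 0 < β * Real.pi ^ 2 := by positivity
  have hw (m : Plaq N → ℤ) : (fun AB => weightM Q β θ AB m) =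
      fun AB : (Link N → ℝ) × (Cube N → ℝ) =>
      Complex.exp (-(Complex.I * ((AB.1 ⬝ᵥ (fun i => ((bd2 m i : ℤ) : ℝ)) : ℝ) : ℂ))) *
        boltzmann Q β θ (fieldM AB.2 m) :=
    funext fun AB => weightM_eq Q β θ AB.1 AB.2 m
  have hd : Continuous fun B : Cube N → ℝ => bd3 B ⬝ᵥ bd3 B :=
    continuous_bd3.dotProduct continuous_bd3
  obtain ⟨h1, h2⟩ := pathConvergent_hasSum (μ := boxMeasureEM N) (w := weightM Q β θ)
    (M := fun AB => Real.exp (β / 2 * (bd3 AB.2 ⬝ᵥ bd3 AB.2)))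
    (u := fun n => Real.exp (-(β * Real.pi ^ 2 * ∑ c, (n c : ℝ) ^ 2)))
    (fun m => by
      rw [hw]
      have h3 : Continuous fun B : Cube N → ℝ => boltzmann Q β θ (fieldM B m) :=
        (continuous_boltzmann hQ β θ).comp (continuous_fieldM m)
      have h4 : Continuous fun A : Link N → ℝ => A ⬝ᵥ (fun i => ((bd2 m i : ℤ) : ℝ)) :=
        continuous_id.dotProduct continuous_const
      have h5 : Continuous fun A : Link N → ℝ =>
          Complex.exp (-(Complex.I * ((A ⬝ᵥ (fun i => ((bd2 m i : ℤ) : ℝ)) : ℝ) : ℂ))) := by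
        fun_prop
      exact ((h5.comp continuous_fst).mul (h3.comp continuous_snd)).aestronglyMeasurable)
    ((integrable_box (f := fun B : Cube N → ℝ => Real.exp (β / 2 * (bd3 B ⬝ᵥ bd3 B)))
      (by fun_prop)).comp_snd _)
    (summable_gaussian_pi hc)
    (fun AB m => by
      rw [show weightM Q β θ AB m = _ from congrFun (hw m) AB, norm_mul, norm_exp_phase, one_mul]
      exact norm_boltzmann_le Q hβ θ (bd3 AB.2) m)
  refine ⟨h1, ?_⟩
  simp only [hw, boxMeasureEM] at h2
  have h5 (m : Plaq N → ℤ) := integral_prod_mul (μ := boxMeasure (Link N))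
    (ν := boxMeasure (Cube N))
    (fun A => Complex.exp (-(Complex.I * ((A ⬝ᵥ (fun i => ((bd2 m i : ℤ) : ℝ)) : ℝ) : ℂ))))
    (fun B => boltzmann Q β θ (fieldM B m))
  simp only [h5, integral_box_exp_neg, mul_comm (ite _ _ _)] at h2
  exact hasSum_subtype_of_mul_ite h2

/-- The path integral with a magnetic gauge field equals the ultra-local partition function, for
every charge that agrees with the ultra-local one in the absence of monopoles. -/
theorem pathIntegral_weightE {Q : (Plaq N → ℝ) → ℝ} (hQ : Continuous Q)
    (hQ0 : ∀ F, d2 F = 0 → Q F = Q0 F) {β : ℝ} (hβ : 0 < β) (θ : ℝ) :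
    PathConvergent (boxMeasureEM N) (weightE Q β θ) ∧
      pathIntegral (boxMeasureEM N) (weightE Q β θ) = Z N β θ := by
  obtain ⟨h1, h2⟩ := weightE_hasSum hQ hβ θ
  refine ⟨h1, h2.unique ?_⟩
  have h3 (A : Link N → ℝ) (n : ClosedForm N) :
      boltzmann Q β θ (fieldE A n.1) = boltzmann Q0 β θ (fieldE A n.1) := by
    have : d2 (fieldE A n.1) = 0 := by
      rw [d2_fieldE, n.2]; funext c; simp
    rw [boltzmann, boltzmann, hQ0 _ this]
  simp only [h3]
  exact (weight_hasSum hβ θ).2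

/-- The duality of closed and coclosed integer 2-forms. -/
def closedEquivCoclosed (N : ℕ) : ClosedForm N ≃ {m : Plaq N → ℤ // bd2 m = 0} :=
  (Equiv.ofBijective _ star2_bijective).subtypeEquiv fun n => (bd2_star2_eq_zero_iff n).symm

/-- Here `A^e` is the multiplier and enforces `∂m = 0`. Then `star1` and `star2` relabel the cells:
they preserve the box measure and the energy, match coclosed with closed integer forms, and turn
`QNL` into `Q0`. -/
theorem pathIntegral_weightM {β : ℝ} (hβ : 0 < β) (θ : ℝ) :
    PathConvergent (boxMeasureEM N) (weightM QNL β θ) ∧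
      pathIntegral (boxMeasureEM N) (weightM QNL β θ) = Z N β θ := by
  obtain ⟨h1, h2⟩ := weightM_hasSum (continuous_chargeNL (epsMatrix N)) hβ θ
  refine ⟨h1, ((closedEquivCoclosed N).hasSum_iff.2 h2).unique ?_⟩
  have hm : MeasurePreserving (star1 : (Link N → ℝ) → Cube N → ℝ) (boxMeasure (Link N))
      (boxMeasure (Cube N)) := measurePreserving_signed_perm (cubeLink N) cubeSign cubeSign_eq
  have h3 (n : ClosedForm N) :
      ∫ B, boltzmann QNL β θ (fieldM B (closedEquivCoclosed N n).1) ∂boxMeasure (Cube N) =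
        ∫ A, boltzmann Q0 β θ (fieldE A n.1) ∂boxMeasure (Link N) := by
    have hc : Continuous fun B : Cube N → ℝ =>
        boltzmann QNL β θ (fieldM B (closedEquivCoclosed N n).1) :=
      (continuous_boltzmann (continuous_chargeNL (epsMatrix N)) β θ).comp (continuous_fieldM _)
    rw [← hm.map_eq, integral_map hm.aemeasurable hc.aestronglyMeasurable]
    congr 1
    funext A
    have hd : d2 (fieldE A n.1) = 0 := by
      rw [d2_fieldE, n.2]; funext c; simp
    have h4 : fieldM (star1 A) (closedEquivCoclosed N n).1 = star2 (fieldE A n.1) :=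
      star2_fieldE A n.1
    rw [h4, boltzmann, boltzmann, star2_dotProduct_star2, QNL_star2_of_closed hd]
  have h4 := (weight_hasSum (N := N) hβ θ).2
  rw [← funext h3] at h4
  exact h4

end PathIntegrals

/-! ### Gaussian integrals against an invariant measure -/

section Gaussian

/-- Uniqueness of Haar measure makes `ν` a multiple of Lebesgue measure, so the power of `β` and the
independence of the centre `w` are inherited from the Euclidean Gaussian. -/
theorem integral_gaussian_of_invariant {V : Type*} [NormedAddCommGroup V] [InnerProductSpace ℝ V]
    [FiniteDimensional ℝ V] [MeasurableSpace V] [BorelSpace V] (ν : Measure V)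
    [ν.IsAddLeftInvariant] [IsFiniteMeasureOnCompacts ν] (hν : ν ≠ 0) :
    ∃ c : ℝ, 0 < c ∧ ∀ β : ℝ, 0 < β → ∀ w : V,
      Integrable (fun y => Real.exp (-(β / 2 * ‖y + w‖ ^ 2))) ν ∧
      ∫ y, Real.exp (-(β / 2 * ‖y + w‖ ^ 2)) ∂ν =
        c / Real.sqrt β ^ Module.finrank ℝ V := by
  have hs := Measure.isAddLeftInvariant_eq_smul ν (volume : Measure V)
  set κ := ν.addHaarScalarFactor (volume : Measure V)
  have hκ : 0 < κ := by
    rw [pos_iff_ne_zero]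
    intro h
    rw [h, zero_smul] at hs
    exact hν hs
  refine ⟨κ * Real.sqrt (2 * Real.pi) ^ Module.finrank ℝ V, by positivity, fun β hβ w => ?_⟩
  have hβ2 : 0 < β / 2 := by positivity
  have h1 := GaussianFourier.integral_rexp_neg_mul_sq_norm (V := V) hβ2
  have h2 : Integrable (fun y : V => Real.exp (-(β / 2 * ‖y‖ ^ 2))) volume := by
    have h3 := (GaussianFourier.integrable_cexp_neg_mul_sq_norm_add (V := V) (b := (β / 2 : ℝ))
      (by simpa using hβ2) 0 0).norm
    refine h3.congr (Filter.Eventually.of_forall fun y => ?_)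
    simp only [Complex.norm_exp, inner_zero_left, Complex.ofReal_zero, mul_zero, add_zero]
    congr 1
    rw [← Complex.ofReal_pow, ← Complex.ofReal_neg, ← Complex.ofReal_mul, Complex.ofReal_re]
    ring
  have h4 : Integrable (fun y => Real.exp (-(β / 2 * ‖y + w‖ ^ 2))) volume :=
    h2.comp_add_right w
  refine ⟨by rw [hs]; exact h4.smul_measure_nnreal, ?_⟩
  rw [hs, integral_smul_nnreal_measure,
    integral_add_right_eq_self (fun y => Real.exp (-(β / 2 * ‖y‖ ^ 2))) w]
  simp only [neg_mul] at h1
  rw [h1, NNReal.smul_def, smul_eq_mul, mul_div_assoc, ← div_pow, ← Real.sqrt_div (by positivity),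
    Real.sqrt_eq_rpow, ← Real.rpow_mul_natCast (by positivity)]
  congr 2
  · field_simp
  · ring

end Gaussian

/-! ### Unfolding the gauge field: the invariant measure on Im d -/

section Exact

theorem two_pi_d1 {N : ℕ} (m : Link N → ℤ) :
    d1 (fun l => 2 * Real.pi * (m l : ℝ)) = fun c => 2 * Real.pi * ((d1 m c : ℤ) : ℝ) :=
  d1_map ((AddMonoidHom.mulLeft (2 * Real.pi)).comp (Int.castAddHom ℝ)) m

variable {N : ℕ} [NeZero N]

/-- The exact integer 2-forms. -/
def exactForms (N : ℕ) : AddSubgroup (Plaq N → ℤ) := (d1Hom N ℤ).range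

/-- The exterior derivative onto its image. -/
def d1Range (N : ℕ) [NeZero N] : (Link N → ℝ) →ₗ[ℝ] imD N :=
  (d1Lin N).codRestrict (imD N) fun A => mem_imD.2 ⟨A, rfl⟩

theorem d1Range_surjective : Surjective (d1Range N) := by
  rintro ⟨F, hF⟩
  obtain ⟨A, rfl⟩ := mem_imD.1 hF
  exact ⟨A, rfl⟩

/-- The real 2-form `2πe` of an exact integer 2-form `e`. -/
def exactVector (e : exactForms N) : imD N :=
  ⟨WithLp.toLp 2 fun c => 2 * Real.pi * (e.1 c : ℝ), by
    obtain ⟨_, m, rfl⟩ := e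
    exact mem_imD.2 ⟨_, congrArg (WithLp.toLp 2) (two_pi_d1 m)⟩⟩

theorem exactVector_add (e f : exactForms N) :
    exactVector (e + f) = exactVector e + exactVector f := by
  ext c
  simp [exactVector, mul_add]

theorem exactVector_d1 (m : Link N → ℤ) :
    exactVector ⟨d1 m, m, rfl⟩ = d1Range N fun l => 2 * Real.pi * (m l : ℝ) :=
  Subtype.ext (congrArg (WithLp.toLp 2) (two_pi_d1 m).symm)

theorem continuous_d1Range_add (v : imD N) : Continuous fun A => d1Range N A + v :=
  (d1Range N).continuous_of_finiteDimensional.add continuous_const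

/-- The distribution of `dA + 2πe`, summed over the exact integer 2-forms `e`. -/
def exactMeasure (N : ℕ) [NeZero N] : Measure (imD N) :=
  Measure.sum fun e : exactForms N =>
    (boxMeasure (Link N)).map fun A => d1Range N A + exactVector e

theorem lintegral_exactMeasure {f : imD N → ENNReal} (hf : Measurable f) :
    ∫⁻ y, f y ∂exactMeasure N =
      ∑' e : exactForms N, ∫⁻ A, f (d1Range N A + exactVector e) ∂boxMeasure (Link N) := by
  rw [exactMeasure, lintegral_sum_measure]
  exact tsum_congr fun e => lintegral_map hf (continuous_d1Range_add _).measurable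

/-- Every vector of Im d is some `dB`, so the translation is a shift of `A` by `B`. The sum over `e`
makes the integrand periodic in `A`, and a shift does not change the integral of a periodic function
over the box. -/
theorem lintegral_exactMeasure_add {f : imD N → ENNReal} (hf : Measurable f) (v : imD N) :
    ∫⁻ y, f (v + y) ∂exactMeasure N = ∫⁻ y, f y ∂exactMeasure N := by
  obtain ⟨B, rfl⟩ := d1Range_surjective v
  have hm (e : exactForms N) : Measurable fun A : Link N → ℝ =>
      f (d1Range N A + exactVector e) := hf.comp (continuous_d1Range_add _).measurable
  have hm' (e : exactForms N) : Measurable fun A : Link N → ℝ =>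
      f (d1Range N B + (d1Range N A + exactVector e)) :=
    (hf.comp (measurable_const_add _)).comp (continuous_d1Range_add _).measurable
  rw [lintegral_exactMeasure hf, lintegral_exactMeasure
      (f := fun y => f (d1Range N B + y)) (hf.comp (measurable_const_add _)),
    ← lintegral_tsum fun e => (hm e).aemeasurable, ← lintegral_tsum fun e => (hm' e).aemeasurable,
    ← lintegral_box_shift (f := fun A => ∑' e, f (d1Range N A + exactVector e)) ?_ B]
  · refine lintegral_congr fun A => tsum_congr fun e => ?_
    rw [map_add]
    congr 1
    abel
  · intro m A
    -- A shift of `A` by `2πm` is absorbed by replacing `e` with `e + dm`.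
    rw [← (Equiv.addLeft (⟨d1 m, m, rfl⟩ : exactForms N)).tsum_eq
      fun e => f (d1Range N A + exactVector e)]
    refine tsum_congr fun e => ?_
    rw [Equiv.coe_addLeft, exactVector_add, exactVector_d1, map_add]
    congr 1
    abel

instance : (exactMeasure N).IsAddLeftInvariant := by
  refine ⟨fun v => Measure.ext fun s hs => ?_⟩
  rw [← lintegral_indicator_one hs, ← lintegral_indicator_one hs,
    lintegral_map (measurable_one.indicator hs) (measurable_const_add v)]
  exact lintegral_exactMeasure_add (measurable_one.indicator hs) v

theorem norm_sq_eq_dotProduct (y : imD N) :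
    ‖y‖ ^ 2 = WithLp.ofLp y.1 ⬝ᵥ WithLp.ofLp y.1 := by
  rw [← inner_toLp, Submodule.coe_norm, ← real_inner_self_eq_norm_sq]

theorem ofLp_d1Range_add (A : Link N → ℝ) (e : exactForms N) :
    WithLp.ofLp (d1Range N A + exactVector e).1 = fieldE A e.1 := rfl

theorem lintegral_gaussian_exactMeasure_lt_top :
    ∫⁻ y, ENNReal.ofReal (Real.exp (-(1 / 2 * ‖y‖ ^ 2))) ∂exactMeasure N < ⊤ := by
  have hc : 0 < 1 * Real.pi ^ 2 := by positivity
  have hm : Measurable fun y : imD N => ENNReal.ofReal (Real.exp (-(1 / 2 * ‖y‖ ^ 2))) := by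
    fun_prop
  have hd : Continuous fun A : Link N → ℝ => d1 A ⬝ᵥ d1 A := continuous_d1.dotProduct continuous_d1
  have hi : Integrable (fun A : Link N → ℝ => Real.exp (1 / 2 * (d1 A ⬝ᵥ d1 A)))
    (boxMeasure (Link N)) := integrable_box (by fun_prop)
  have hs : Summable fun e : exactForms N =>
      Real.exp (-(1 * Real.pi ^ 2 * ∑ c, (e.1 c : ℝ) ^ 2)) :=
    (summable_gaussian_pi hc).comp_injective Subtype.val_injective
  rw [lintegral_exactMeasure hm]
  refine lt_of_le_of_lt (ENNReal.tsum_le_tsum fun e => lintegral_mono fun A => ?_)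
    (b := ∑' e : exactForms N, ∫⁻ A, ENNReal.ofReal (Real.exp (1 / 2 * (d1 A ⬝ᵥ d1 A))) *
      ENNReal.ofReal (Real.exp (-(1 * Real.pi ^ 2 * ∑ c, (e.1 c : ℝ) ^ 2)))
        ∂boxMeasure (Link N)) ?_
  · rw [← ENNReal.ofReal_mul (Real.exp_pos _).le]
    refine ENNReal.ofReal_le_ofReal ?_
    -- Only the norm of the weight matters, so the charge and the angle are arbitrary here; the
    -- coupling is 1.
    have h := norm_boltzmann_le Q0 one_pos 0 (d1 A) e.1
    rw [norm_boltzmann] at h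
    rw [norm_sq_eq_dotProduct, ofLp_d1Range_add]
    exact h
  · have h1 (e : exactForms N) := lintegral_mul_const' (μ := boxMeasure (Link N))
      (ENNReal.ofReal (Real.exp (-(1 * Real.pi ^ 2 * ∑ c, (e.1 c : ℝ) ^ 2))))
      (fun A : Link N → ℝ => ENNReal.ofReal (Real.exp (1 / 2 * (d1 A ⬝ᵥ d1 A))))
      ENNReal.ofReal_ne_top
    simp only [h1]
    rw [ENNReal.tsum_mul_left]
    exact ENNReal.mul_lt_top hi.lintegral_lt_top hs.tsum_ofReal_lt_top

/-- A compact set lies in a ball, on which the Gaussian is bounded below; since the Gaussian has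
finite integral, Markov's inequality applies. -/
instance : IsFiniteMeasureOnCompacts (exactMeasure N) := by
  refine ⟨fun K hK => ?_⟩
  obtain ⟨r, hr⟩ := hK.isBounded.subset_closedBall (0 : imD N)
  set ε := ENNReal.ofReal (Real.exp (-(1 / 2 * r ^ 2))) with hε
  have hm : Measurable fun y : imD N => ENNReal.ofReal (Real.exp (-(1 / 2 * ‖y‖ ^ 2))) := by
    fun_prop
  have hε0 : ε ≠ 0 := by
    rw [hε, Ne, ENNReal.ofReal_eq_zero, not_le]; exact Real.exp_pos _
  refine lt_of_le_of_lt (measure_mono fun y hy => ?_)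
    (lt_of_le_of_lt (meas_ge_le_lintegral_div hm.aemeasurable hε0 ENNReal.ofReal_ne_top)
      (ENNReal.div_lt_top lintegral_gaussian_exactMeasure_lt_top.ne hε0))
  have h1 : ‖y‖ ≤ r := by simpa using hr hy
  have h2 : ‖y‖ ^ 2 ≤ r ^ 2 := by gcongr
  exact ENNReal.ofReal_le_ofReal (Real.exp_le_exp.2 (by linarith))

theorem exactMeasure_ne_zero : exactMeasure N ≠ 0 := by
  intro h
  have h1 := lintegral_exactMeasure (N := N) (f := fun _ => 1) measurable_const
  rw [h, lintegral_zero_measure] at h1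
  have h2 := ENNReal.tsum_eq_zero.1 h1.symm 0
  simp at h2

/-- Gauge invariance and scaling of the integral over the continuous fields and the exact integer
forms. -/
theorem exists_hasSum_exact (N : ℕ) [NeZero N] :
    ∃ c : ℝ, 0 < c ∧ ∀ β : ℝ, 0 < β → ∀ w : imD N,
      HasSum (fun e : exactForms N =>
        ∫ A, Real.exp (-(β / 2 * ‖d1Range N A + exactVector e + w‖ ^ 2)) ∂boxMeasure (Link N))
        (c / Real.sqrt β ^ (3 * (N ^ 4 - 1))) := by
  obtain ⟨c, hc, h⟩ := integral_gaussian_of_invariant (exactMeasure N) exactMeasure_ne_zero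
  refine ⟨c, hc, fun β hβ w => ?_⟩
  obtain ⟨h1, h2⟩ := h β hβ w
  rw [finrank_imD] at h2
  have h3 := hasSum_integral_measure (μ := fun e : exactForms N =>
    (boxMeasure (Link N)).map fun A => d1Range N A + exactVector e) h1
  rw [← exactMeasure, h2] at h3
  have hcont : Continuous fun y : imD N => Real.exp (-(β / 2 * ‖y + w‖ ^ 2)) := by fun_prop
  have h4 (e : exactForms N) := integral_map (μ := boxMeasure (Link N))
    (continuous_d1Range_add (exactVector e)).measurable.aemeasurable
    (f := fun y : imD N => Real.exp (-(β / 2 * ‖y + w‖ ^ 2))) hcont.aestronglyMeasurable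
  simpa only [h4] using h3

end Exact

/-! ### Reduction of `Z` to a sum over six fluxes -/

section Fluxes

variable {N : ℕ} [NeZero N]

/-- Closed integer 2-forms are parametrised by an exact form and six fluxes. -/
def fluxEquiv (N : ℕ) [NeZero N] : (Dir2 → ℤ) × exactForms N ≃ ClosedForm N where
  toFun q := ⟨q.2.1 + fluxForm N q.1, by
    obtain ⟨m, hm⟩ := q.2.2
    rw [← hm]
    change d2 (d1 m + _) = 0
    rw [d2_add, d2_d1, d2_fluxForm, add_zero]⟩
  invFun n := (period n.1, ⟨n.1 - fluxForm N (period n.1), by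
    obtain ⟨A, hA⟩ := exists_eq_d1_add_fluxForm n.2
    exact ⟨A, eq_sub_of_add_eq hA.symm⟩⟩)
  left_inv q := by
    obtain ⟨k, _, m, rfl⟩ := q
    have h : period (d1 m + fluxForm N k) = k := by
      rw [period_add, period_d1, period_fluxForm, zero_add]
    refine Prod.ext h (Subtype.ext ?_)
    change d1 m + fluxForm N k - fluxForm N (period (d1 m + fluxForm N k)) = d1 m
    rw [h, add_sub_cancel_right]
  right_inv n := Subtype.ext (sub_add_cancel _ _)

/-- The Boltzmann weight of the harmonic field with fluxes `2πk`. -/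
def fluxWeight (β θ : ℝ) (k : Dir2 → ℤ) : ℂ :=
  Complex.exp (-((β / 2 * (4 * Real.pi ^ 2 * ∑ p, (k p : ℝ) ^ 2) : ℝ) : ℂ) -
    Complex.I * ((θ * ((k ⟨(0, 1), by decide⟩ : ℝ) * k ⟨(2, 3), by decide⟩
      - k ⟨(0, 2), by decide⟩ * k ⟨(1, 3), by decide⟩
      + k ⟨(0, 3), by decide⟩ * k ⟨(1, 2), by decide⟩) : ℝ) : ℂ))

/-- The constant 2-form with fluxes `2πk`. -/
def constForm (N : ℕ) (k : Dir2 → ℤ) : Plaq N → ℝ := fun c => 2 * Real.pi * (k c.2 / (N : ℝ) ^ 2)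

/-- The constant form spreads each flux `2πk` evenly over the N² plaquettes of a coordinate torus.
Equal fluxes mean an exact difference, and the constant representative is harmonic. -/
theorem exists_fluxForm_eq (k : Dir2 → ℤ) :
    ∃ B : Link N → ℝ, (fun c => 2 * Real.pi * ((fluxForm N k c : ℤ) : ℝ)) = d1 B + constForm N k := by
  obtain ⟨A, hA⟩ := exists_eq_d1_add_fluxForm (d2_const (N := N)
    fun p => 2 * Real.pi * ((k p : ℝ) / (N : ℝ) ^ 2))
  rw [period_const fun p => 2 * Real.pi * ((k p : ℝ) / (N : ℝ) ^ 2)] at hA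
  refine ⟨-A, ?_⟩
  have hN : (N : ℝ) ≠ 0 := Nat.cast_ne_zero.2 (NeZero.ne N)
  have h1 : fluxForm N ((N : ℝ) ^ 2 • fun p => 2 * Real.pi * ((k p : ℝ) / (N : ℝ) ^ 2)) =
      fun c => 2 * Real.pi * ((fluxForm N k c : ℤ) : ℝ) := by
    funext c
    simp only [fluxForm, Pi.smul_apply, smul_eq_mul]
    split_ifs
    · field_simp
    · simp
  have h2 : d1 (-A) = -d1 A := map_neg (d1Hom N ℝ) A
  rw [h1] at hA
  have h3 : constForm N k = d1 A + fun c => 2 * Real.pi * ((fluxForm N k c : ℤ) : ℝ) := hA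
  rw [h2, h3]
  abel

theorem constForm_dotProduct (k : Dir2 → ℤ) :
    constForm N k ⬝ᵥ constForm N k = 4 * Real.pi ^ 2 * ∑ p, (k p : ℝ) ^ 2 := by
  have hN : (N : ℝ) ≠ 0 := Nat.cast_ne_zero.2 (NeZero.ne N)
  simp only [dotProduct, Fintype.sum_prod_type, constForm, Finset.sum_const, Finset.card_univ,
    Fintype.card_fun, ZMod.card, Fintype.card_fin, nsmul_eq_mul, Finset.mul_sum]
  refine Finset.sum_congr rfl fun p _ => ?_
  push_cast
  field_simp
  ring

theorem constForm_star2 (k : Dir2 → ℤ) :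
    1 / (8 * Real.pi ^ 2) * (constForm N k ⬝ᵥ star2 (constForm N k)) =
      (k ⟨(0, 1), by decide⟩ : ℝ) * k ⟨(2, 3), by decide⟩
      - k ⟨(0, 2), by decide⟩ * k ⟨(1, 3), by decide⟩
      + k ⟨(0, 3), by decide⟩ * k ⟨(1, 2), by decide⟩ := by
  have hN : (N : ℝ) ≠ 0 := Nat.cast_ne_zero.2 (NeZero.ne N)
  simp only [dotProduct, Fintype.sum_prod_type, sum_dir2, star2_apply]
  simp only [constForm, Finset.sum_const, Finset.card_univ,
    Fintype.card_fun, ZMod.card, Fintype.card_fin, nsmul_eq_mul]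
  push_cast
  field_simp
  ring

theorem d1_add_dotProduct (B : Link N → ℝ) (F : Plaq N → ℝ) (h : bd2 F = 0) :
    (d1 B + F) ⬝ᵥ (d1 B + F) = d1 B ⬝ᵥ d1 B + F ⬝ᵥ F := by
  have h1 : d1 B ⬝ᵥ F = 0 := by rw [d1_dotProduct, h, dotProduct_zero]
  rw [dotProduct_add, add_dotProduct, add_dotProduct, h1, dotProduct_comm F, h1]
  ring

/-- The energy splits because a constant form is coclosed, hence orthogonal to Im d; the charge does
not see `dB` at all. -/
theorem boltzmann_d1_add_constForm (β θ : ℝ) (B : Link N → ℝ) (k : Dir2 → ℤ) :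
    boltzmann Q0 β θ (d1 B + constForm N k) =
      fluxWeight β θ k * ((Real.exp (-(β / 2 * (d1 B ⬝ᵥ d1 B))) : ℝ) : ℂ) := by
  have hd : d2 (constForm N k) = 0 := d2_const fun p => 2 * Real.pi * ((k p : ℝ) / (N : ℝ) ^ 2)
  have hb : bd2 (constForm N k) = 0 := bd2_const fun p => 2 * Real.pi * ((k p : ℝ) / (N : ℝ) ^ 2)
  rw [boltzmann, Q0_eq, star2_quadratic_add_d1 B hd, d1_add_dotProduct B _ hb,
    constForm_dotProduct, constForm_star2, fluxWeight, Complex.ofReal_exp, ← Complex.exp_add]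
  congr 1
  push_cast
  ring

theorem exists_Z_hasSum (N : ℕ) [NeZero N] :
    ∃ c : ℝ, 0 < c ∧ ∀ β θ : ℝ, 0 < β →
      HasSum (fun k => fluxWeight β θ k * ((c / Real.sqrt β ^ (3 * (N ^ 4 - 1)) : ℝ) : ℂ))
        (Z N β θ) := by
  obtain ⟨c, hc, h⟩ := exists_hasSum_exact N
  refine ⟨c, hc, fun β θ hβ => ?_⟩
  have h1 := (fluxEquiv N).hasSum_iff.2 (weight_hasSum (N := N) hβ θ).2
  refine h1.prod_fiberwise fun k => ?_
  obtain ⟨B, hB⟩ := exists_fluxForm_eq (N := N) k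
  -- The flux `k` only moves the centre of the Gaussian by `dB`, so the sum over exact forms gives
  -- the same factor for every `k`.
  have h2 := (Complex.hasSum_ofReal.2 (h β hβ (d1Range N B))).mul_left (fluxWeight β θ k)
  refine Eq.mp (congrArg (fun f => HasSum f _) (funext fun e => ?_)) h2
  rw [← integral_complex_ofReal, ← integral_const_mul]
  simp only [comp_apply]
  congr 1
  funext A
  obtain ⟨_, m, rfl⟩ := e
  have h3 : fieldE A (fluxEquiv N (k, ⟨_, m, rfl⟩)).1 =
      d1 (A + (fun l => 2 * Real.pi * (m l : ℝ)) + B) + constForm N k := by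
    rw [d1_add, d1_add, two_pi_d1, add_assoc, ← hB]
    funext c
    change d1 A c + 2 * Real.pi * ((d1 m c + fluxForm N k c : ℤ) : ℝ) = d1 A c +
      2 * Real.pi * ((d1 m c : ℤ) : ℝ) + 2 * Real.pi * ((fluxForm N k c : ℤ) : ℝ)
    push_cast
    ring
  refine Eq.trans ?_ (congrArg (boltzmann Q0 β θ) h3).symm
  rw [boltzmann_d1_add_constForm, norm_sq_eq_dotProduct]
  congr 5
  all_goals
  · rw [d1_add, d1_add, two_pi_d1]
    rfl

/-- The Boltzmann weight of a pair of fluxes through dual tori. -/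
def pairWeight (β θ : ℝ) (p : ℤ × ℤ) : ℂ :=
  Complex.exp (-((2 * Real.pi ^ 2 * β * ((p.1 : ℝ) ^ 2 + (p.2 : ℝ) ^ 2) : ℝ) : ℂ) -
    Complex.I * ((θ * ((p.1 : ℝ) * p.2) : ℝ) : ℂ))

/-- The six fluxes as three pairs of fluxes through dual tori. -/
def fluxPairs : (Dir2 → ℤ) ≃ (Fin 3 → ℤ × ℤ) where
  toFun k := ![(k ⟨(0, 1), by decide⟩, k ⟨(2, 3), by decide⟩),
    -- The minus sign absorbs `ε₀₂₁₃ = -1`, so that all three pairs carry the same weight.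
    (-k ⟨(0, 2), by decide⟩, k ⟨(1, 3), by decide⟩), (k ⟨(0, 3), by decide⟩, k ⟨(1, 2), by decide⟩)]
  invFun p q := if q.1 = (0, 1) then (p 0).1 else if q.1 = (2, 3) then (p 0).2
    else if q.1 = (0, 2) then -(p 1).1 else if q.1 = (1, 3) then (p 1).2
    else if q.1 = (0, 3) then (p 2).1 else (p 2).2
  left_inv k := by
    funext q
    induction q using dir2_cases <;> simp
  right_inv p := by
    funext j
    fin_cases j <;> simp

theorem fluxWeight_eq (β θ : ℝ) (k : Dir2 → ℤ) :
    fluxWeight β θ k = ∏ j, pairWeight β θ (fluxPairs k j) := by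
  simp only [fluxWeight, pairWeight, fluxPairs, Fin.prod_univ_three, ← Complex.exp_add, sum_dir2]
  congr 1
  simp
  ring

theorem summable_pairWeight {β : ℝ} (hβ : 0 < β) (θ : ℝ) : Summable (pairWeight β θ) := by
  have hc : 0 < 2 * Real.pi ^ 2 * β := by positivity
  have h := (summable_gaussian_int hc).mul_of_nonneg (summable_gaussian_int hc)
    (fun _ => (Real.exp_pos _).le) (fun _ => (Real.exp_pos _).le)
  refine Summable.of_norm (h.congr fun p => ?_)
  rw [pairWeight, Complex.norm_exp, ← Real.exp_add]
  congr 1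
  rw [mul_comm Complex.I]
  simp only [Complex.sub_re, Complex.neg_re, Complex.ofReal_re, Complex.re_ofReal_mul,
    Complex.I_re, mul_zero, sub_zero]
  ring

theorem exists_Z_eq (N : ℕ) [NeZero N] :
    ∃ c : ℝ, 0 < c ∧ ∀ β θ : ℝ, 0 < β →
      Z N β θ = ((c / Real.sqrt β ^ (3 * (N ^ 4 - 1)) : ℝ) : ℂ) * (∑' p, pairWeight β θ p) ^ 3 := by
  obtain ⟨c, hc, h⟩ := exists_Z_hasSum N
  refine ⟨c, hc, fun β θ hβ => ?_⟩
  have h1 := tsum_prod_pi (ι := Fin 3) fun _ => summable_pairWeight hβ θ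
  rw [Finset.prod_const, Finset.card_univ, Fintype.card_fin] at h1
  rw [← (h β θ hβ).tsum_eq, tsum_mul_right, mul_comm, ← h1, ← fluxPairs.tsum_eq]
  simp only [fluxWeight_eq]

end Fluxes

/-! ### Theta functions and their transformation under `τ ↦ -1/τ` -/

section Theta

/-- The sum of the squared norms of the two theta functions of the modified Villain model. -/
def thetaSum (τ : ℂ) : ℝ :=
  ‖thetaChar 0 0 0 (2 * τ)‖ ^ 2 + ‖thetaChar (1 / 2) 0 0 (2 * τ)‖ ^ 2

/-- The summand of a theta function with first characteristic `α` at `2τ`. -/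
def thetaTerm (α : ℝ) (τ : ℂ) (n : ℤ) : ℂ :=
  Complex.exp (2 * Complex.I * Real.pi * τ * ((n : ℂ) + α) ^ 2)

theorem thetaChar_eq (α : ℝ) (τ : ℂ) : thetaChar α 0 0 (2 * τ) = ∑' n, thetaTerm α τ n := by
  refine tsum_congr fun n => ?_
  rw [thetaTerm]
  congr 1
  push_cast
  ring

theorem summable_thetaTerm (α : ℝ) {τ : ℂ} (hτ : 0 < τ.im) : Summable (thetaTerm α τ) := by
  have h2 : 0 < (2 * τ).im := by simpa using hτ
  have h := ((summable_jacobiTheta₂_term_iff (2 * τ * α) (2 * τ)).2 h2).mul_left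
    (Complex.exp (2 * Complex.I * Real.pi * τ * α ^ 2))
  refine h.congr fun n => ?_
  rw [jacobiTheta₂_term, thetaTerm, ← Complex.exp_add]
  congr 1
  ring

/-- Pairs of integers by the parity of their sum. -/
def parityEquiv : (ℤ × ℤ) ⊕ (ℤ × ℤ) ≃ ℤ × ℤ where
  toFun := Sum.elim (fun p => (p.2 - p.1, p.2 + p.1)) fun p => (p.2 - p.1, p.2 + p.1 + 1)
  invFun p := if (p.1 + p.2) % 2 = 0 then Sum.inl ((p.2 - p.1) / 2, (p.1 + p.2) / 2)
    else Sum.inr ((p.2 - p.1 - 1) / 2, (p.1 + p.2 - 1) / 2)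
  left_inv p := by
    rcases p with ⟨a, b⟩ | ⟨a, b⟩
    · refine (if_pos (by simp only [Sum.elim_inl]; omega)).trans (congrArg Sum.inl ?_)
      simp only [Sum.elim_inl, Prod.mk.injEq]
      omega
    · refine (if_neg (by simp only [Sum.elim_inr]; omega)).trans (congrArg Sum.inr ?_)
      simp only [Sum.elim_inr, Prod.mk.injEq]
      omega
  right_inv p := by
    rcases p with ⟨a, b⟩
    simp only
    split_ifs
    · simp only [Sum.elim_inl, Prod.mk.injEq]; omega
    · simp only [Sum.elim_inr, Prod.mk.injEq]; omega

/-- With `a = n + α` and `b = m + α`, use `a² - b² = -(b - a)(b + a)` and `2(a² + b²) = (b - a)² +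
(b + a)²`. -/
theorem thetaTerm_mul_conj {β θ : ℝ} (α : ℝ) (n m : ℤ) :
    thetaTerm α (tau β θ) n * star (thetaTerm α (tau β θ) m) =
      Complex.exp (-((2 * Real.pi ^ 2 * β * (((m : ℝ) - n) ^ 2 + (m + n + 2 * α) ^ 2) : ℝ) : ℂ) -
        Complex.I * ((θ * (((m : ℝ) - n) * (m + n + 2 * α)) : ℝ) : ℂ)) := by
  have hπ : (Real.pi : ℂ) ≠ 0 := by exact_mod_cast Real.pi_ne_zero
  rw [thetaTerm, thetaTerm, Complex.star_def, ← Complex.exp_conj, ← Complex.exp_add]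
  congr 1
  simp only [map_mul, map_pow, map_add, Complex.conj_I, Complex.conj_ofReal, tau, map_div₀,
    map_ofNat, map_intCast]
  push_cast
  field_simp
  ring_nf
  simp only [Complex.I_sq]
  ring

theorem hasSum_norm_sq {f : ℤ → ℂ} (hf : Summable f) :
    HasSum (fun p : ℤ × ℤ => f p.1 * star (f p.2)) ((‖∑' n, f n‖ ^ 2 : ℝ) : ℂ) := by
  have hs : Summable fun n => star (f n) := hf.star
  have h1 := summable_mul_of_summable_norm hf.norm hs.norm
  have h2 := tsum_mul_tsum_of_summable_norm hf.norm hs.norm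
  rw [← tsum_star] at h2
  have h3 : ((‖∑' n, f n‖ ^ 2 : ℝ) : ℂ) = (∑' n, f n) * star (∑' n, f n) := by
    rw [Complex.star_def, Complex.mul_conj']
    push_cast
    rfl
  rw [h3, h2]
  exact h1.hasSum

theorem im_tau {β : ℝ} (θ : ℝ) : (tau β θ).im = 2 * Real.pi * β := by
  have h : tau β θ = ((θ / (2 * Real.pi) : ℝ) : ℂ) + ((2 * Real.pi * β : ℝ) : ℂ) * Complex.I := by
    rw [tau]; push_cast; ring
  rw [h]
  simp only [Complex.add_im, Complex.ofReal_im, Complex.im_ofReal_mul, Complex.I_im, zero_add,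
    mul_one]

theorem re_tau {β : ℝ} (θ : ℝ) : (tau β θ).re = θ / (2 * Real.pi) := by
  have h : tau β θ = ((θ / (2 * Real.pi) : ℝ) : ℂ) + ((2 * Real.pi * β : ℝ) : ℂ) * Complex.I := by
    rw [tau]; push_cast; ring
  rw [h]
  simp only [Complex.add_re, Complex.ofReal_re, Complex.re_ofReal_mul, Complex.I_re, mul_zero,
    add_zero]

/-- In the variables `(m - n, m + n + 2α)`, characteristic 0 runs over the pairs with even sum and
characteristic 1/2 over those with odd sum. -/
theorem tsum_pairWeight {β : ℝ} (hβ : 0 < β) (θ : ℝ) :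
    ∑' p, pairWeight β θ p = (thetaSum (tau β θ) : ℂ) := by
  have hτ : 0 < (tau β θ).im := by rw [im_tau]; positivity
  have h0 := hasSum_norm_sq (summable_thetaTerm 0 hτ)
  have h1 := hasSum_norm_sq (summable_thetaTerm (1 / 2) hτ)
  rw [← thetaChar_eq] at h0 h1
  refine HasSum.tsum_eq (parityEquiv.hasSum_iff.1 ?_)
  rw [thetaSum, Complex.ofReal_add]
  refine HasSum.sum ?_ ?_
  · refine Eq.mp (congrArg (fun f => HasSum f _) (funext fun p => ?_)) h0
    rw [thetaTerm_mul_conj]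
    simp [pairWeight, parityEquiv]
  · refine Eq.mp (congrArg (fun f => HasSum f _) (funext fun p => ?_)) h1
    rw [thetaTerm_mul_conj]
    simp [pairWeight, parityEquiv]

theorem jacobiTheta_half {τ : ℂ} (hτ : 0 < τ.im) :
    jacobiTheta₂ 0 (τ / 2) = thetaChar 0 0 0 (2 * τ) + thetaChar (1 / 2) 0 0 (2 * τ) := by
  rw [thetaChar_eq, thetaChar_eq]
  have h0 := (summable_thetaTerm 0 hτ).hasSum
  have h1 := (summable_thetaTerm (1 / 2) hτ).hasSum
  let e : ℤ ⊕ ℤ ≃ ℤ :=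
    { toFun := Sum.elim (fun n => 2 * n) fun n => 2 * n + 1
      invFun := fun n => if n % 2 = 0 then Sum.inl (n / 2) else Sum.inr (n / 2)
      left_inv := by
        rintro (n | n)
        · refine (if_pos (by simp only [Sum.elim_inl]; omega)).trans (congrArg Sum.inl ?_)
          simp only [Sum.elim_inl]
          omega
        · refine (if_neg (by simp only [Sum.elim_inr]; omega)).trans (congrArg Sum.inr ?_)
          simp only [Sum.elim_inr]
          omega
      right_inv := fun n => by
        simp only
        split_ifs
        · simp only [Sum.elim_inl]; omega
        · simp only [Sum.elim_inr]; omega }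
  refine HasSum.tsum_eq (e.hasSum_iff.1 (HasSum.sum ?_ ?_))
  · refine Eq.mp (congrArg (fun f => HasSum f _) (funext fun n => ?_)) h0
    simp only [comp_apply, e, Equiv.coe_fn_mk, Sum.elim_inl, jacobiTheta₂_term, thetaTerm]
    congr 1
    push_cast
    ring
  · refine Eq.mp (congrArg (fun f => HasSum f _) (funext fun n => ?_)) h1
    simp only [comp_apply, e, Equiv.coe_fn_mk, Sum.elim_inr, jacobiTheta₂_term, thetaTerm]
    congr 1
    push_cast
    ring

theorem jacobiTheta_two_mul (τ : ℂ) : jacobiTheta₂ 0 (2 * τ) = thetaChar 0 0 0 (2 * τ) := by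
  rw [thetaChar_eq, jacobiTheta₂]
  refine tsum_congr fun n => ?_
  rw [jacobiTheta₂_term, thetaTerm]
  congr 1
  push_cast
  ring

theorem thetaChar_zero_S {τ : ℂ} (hτ : 0 < τ.im) :
    thetaChar 0 0 0 (2 * (-1 / τ)) = (-Complex.I * (τ / 2)) ^ (1 / 2 : ℂ) *
      (thetaChar 0 0 0 (2 * τ) + thetaChar (1 / 2) 0 0 (2 * τ)) := by
  have h0 : τ ≠ 0 := by rintro rfl; simp at hτ
  have h := jacobiTheta₂_functional_equation 0 (τ / 2)
  have h1 : -1 / (τ / 2) = 2 * (-1 / τ) := by field_simp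
  have h2 : (-Complex.I * (τ / 2)) ^ (1 / 2 : ℂ) ≠ 0 := by
    rw [Complex.cpow_ne_zero_iff]
    left
    simp [h0]
  rw [jacobiTheta_half hτ, h1, zero_div, jacobiTheta_two_mul] at h
  rw [h]
  field_simp
  simp

/-- In the right half plane the principal root is compatible with inversion, so the automorphy
factors at `τ` and `-1/τ` multiply to 1/2 with no sign ambiguity. -/
theorem two_mul_cpow_half_mul {z : ℂ} (hz : 0 < z.re) :
    2 * z ^ (1 / 2 : ℂ) * ((1 / (4 * z)) ^ (1 / 2 : ℂ)) = 1 := by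
  have h0 : z ≠ 0 := by rintro rfl; simp at hz
  have h4 : Complex.log (4 * z) = Real.log 4 + Complex.log z := by
    have := Complex.log_ofReal_mul (r := 4) (by norm_num) h0
    simpa using this
  have hre : 0 < (4 * z).re := by
    have : (4 * z).re = 4 * z.re := by simp
    rw [this]; positivity
  have harg : (4 * z).arg ≠ Real.pi := by
    rw [Ne, Complex.arg_eq_pi_iff]
    exact fun h => absurd h.1 hre.le.not_gt
  have hlog : (Real.log 4 : ℂ) * (1 / 2) = (Real.log 2 : ℝ) := by
    have : Real.log 4 = 2 * Real.log 2 := by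
      rw [show (4 : ℝ) = 2 ^ 2 by norm_num, Real.log_pow]; norm_num
    rw [this]; push_cast; ring
  have h5 : (4 * z) ^ (1 / 2 : ℂ) = 2 * z ^ (1 / 2 : ℂ) := by
    rw [Complex.cpow_def_of_ne_zero (mul_ne_zero (by norm_num) h0), h4, add_mul, hlog,
      Complex.exp_add, ← Complex.ofReal_exp, Real.exp_log two_pos,
      Complex.cpow_def_of_ne_zero h0]
    norm_num
  rw [one_div (4 * z), Complex.inv_cpow _ _ harg, h5]
  exact mul_inv_cancel₀ (by simp [h0])

/-- The pair `(f, g)` of theta values goes to `r(f + g, f - g)` with `|r|² = |τ|/2`, and the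
parallelogram law supplies the factor 2. -/
theorem thetaSum_S {τ : ℂ} (hτ : 0 < τ.im) : thetaSum (-1 / τ) = ‖τ‖ * thetaSum τ := by
  have h0 : τ ≠ 0 := by rintro rfl; simp at hτ
  have hτ' : 0 < (-1 / τ).im := by
    rw [neg_div, one_div, Complex.neg_im, Complex.inv_im, neg_div, neg_neg]
    exact div_pos hτ (Complex.normSq_pos.2 h0)
  set f := thetaChar 0 0 0 (2 * τ) with hf
  set g := thetaChar (1 / 2) 0 0 (2 * τ) with hg
  set r := (-Complex.I * (τ / 2)) ^ (1 / 2 : ℂ) with hr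
  have h1 : thetaChar 0 0 0 (2 * (-1 / τ)) = r * (f + g) := thetaChar_zero_S hτ
  have h2 := thetaChar_zero_S hτ'
  have h3 : -1 / (-1 / τ) = τ := by field_simp
  have h4 : -Complex.I * (-1 / τ / 2) = 1 / (4 * (-Complex.I * (τ / 2))) := by
    field_simp
    linear_combination (4 : ℂ) * Complex.I_sq
  have h5 := two_mul_cpow_half_mul (z := -Complex.I * (τ / 2)) (by
    have : -Complex.I * (τ / 2) = (-Complex.I * τ) / (2 : ℝ) := by push_cast; ring
    rw [this, Complex.div_ofReal_re]
    simpa using hτ)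
  rw [h3, h4, h1, ← hf] at h2
  -- Jacobi's equation is used only for the first theta function. Applying it at `-1/τ` as well
  -- returns `f`, and solving for the unknown gives the second.
  have h6 : thetaChar (1 / 2) 0 0 (2 * (-1 / τ)) = r * (f - g) := by
    linear_combination (-2 * r) * h2 - (r * (f + g) + thetaChar (1 / 2) 0 0 (2 * (-1 / τ))) * h5
  have h7 : ‖r‖ ^ 2 = ‖τ‖ / 2 := by
    rw [← norm_pow, hr, ← Complex.cpow_mul_nat]
    simp
  have h8 := parallelogram_law_with_norm ℝ f g
  rw [thetaSum, thetaSum, h1, h6, norm_mul, norm_mul, mul_pow, mul_pow, h7, ← hf, ← hg]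
  linear_combination (‖τ‖ / 2) * h8

end Theta

/-! ### S-duality, T-duality and modular invariance -/

section Modular

variable {N : ℕ} [NeZero N]

theorem tau_ext {β β' θ θ' : ℝ} (h : tau β θ = tau β' θ') : β = β' ∧ θ = θ' := by
  have h1 := congrArg Complex.re h
  have h2 := congrArg Complex.im h
  have hπ := Real.pi_ne_zero
  rw [re_tau, re_tau] at h1
  rw [im_tau, im_tau] at h2
  field_simp at h1 h2
  exact ⟨h2, h1⟩

theorem normSq_tau (β θ : ℝ) :
    Complex.normSq (tau β θ) = (2 * Real.pi * β) ^ 2 + (θ / (2 * Real.pi)) ^ 2 := by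
  rw [Complex.normSq_apply, re_tau, im_tau]
  ring

theorem normSq_tau_pos {β : ℝ} (hβ : 0 < β) (θ : ℝ) :
    0 < (2 * Real.pi * β) ^ 2 + (θ / (2 * Real.pi)) ^ 2 := by positivity

theorem dualBeta_pos {β : ℝ} (hβ : 0 < β) (θ : ℝ) : 0 < dualBeta β θ :=
  div_pos hβ (normSq_tau_pos hβ θ)

theorem neg_one_div_tau (β θ : ℝ) :
    -1 / tau β θ = tau (dualBeta β θ) (dualTheta β θ) := by
  rw [neg_div, one_div]
  apply Complex.ext
  · rw [Complex.neg_re, Complex.inv_re, normSq_tau, re_tau, re_tau, dualTheta]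
    ring
  · rw [Complex.neg_im, Complex.inv_im, normSq_tau, im_tau, im_tau, dualBeta]
    ring

theorem sqrt_dualBeta_div {β : ℝ} (hβ : 0 < β) (θ : ℝ) :
    Real.sqrt (dualBeta β θ / β) = ‖tau β θ‖⁻¹ := by
  have h : dualBeta β θ / β = (‖tau β θ‖⁻¹) ^ 2 := by
    rw [inv_pow, ← Complex.normSq_eq_norm_sq, normSq_tau, dualBeta]
    field_simp
  rw [h, Real.sqrt_sq (by positivity)]

/-- Since `√(β̃/β) = 1/|τ|`, the Gaussian prefactor contributes `|τ|` to the power 3(N⁴ - 1) and the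
three theta sums contribute `|τ|³`, in all `|τ|` to the power 3N⁴. -/
theorem Z_S_dual {β : ℝ} (hβ : 0 < β) (θ : ℝ) :
    Z N β θ = ((Real.sqrt (dualBeta β θ / β) ^ (3 * N ^ 4) : ℝ) : ℂ) *
      Z N (dualBeta β θ) (dualTheta β θ) := by
  obtain ⟨c, -, h⟩ := exists_Z_eq N
  have hd := dualBeta_pos hβ θ
  have hτ : 0 < (tau β θ).im := by rw [im_tau]; positivity
  have hn : 0 < ‖tau β θ‖ := norm_pos_iff.2 fun h0 => by simp [h0] at hτ
  rw [h β θ hβ, h _ _ hd, tsum_pairWeight hβ, tsum_pairWeight hd, ← neg_one_div_tau,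
    thetaSum_S hτ]
  have h1 : Real.sqrt (dualBeta β θ) = ‖tau β θ‖⁻¹ * Real.sqrt β := by
    rw [← sqrt_dualBeta_div hβ, ← Real.sqrt_mul (by positivity), div_mul_cancel₀ _ hβ.ne']
  rw [h1, sqrt_dualBeta_div hβ]
  obtain ⟨M, hM⟩ : ∃ M, N ^ 4 = M + 1 :=
    ⟨N ^ 4 - 1, (Nat.sub_add_cancel (Nat.one_le_pow _ _ (NeZero.pos N))).symm⟩
  have hs : 0 < Real.sqrt β := Real.sqrt_pos.2 hβ
  rw [hM, Nat.add_sub_cancel]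
  norm_cast
  simp only [mul_add, pow_add, mul_pow, inv_pow]
  field_simp

theorem Z_T_dual {β : ℝ} (hβ : 0 < β) (θ : ℝ) : Z N β (θ + 2 * Real.pi) = Z N β θ := by
  obtain ⟨c, -, h⟩ := exists_Z_eq N
  rw [h _ _ hβ, h _ _ hβ]
  congr 2
  -- The charge of a pair of fluxes is the integer `p.1 * p.2`, so each weight is itself periodic in
  -- the angle.
  refine tsum_congr fun p => Complex.exp_eq_exp_iff_exists_int.2 ⟨-(p.1 * p.2), ?_⟩
  push_cast
  ring

theorem tau_coe (τ : UpperHalfPlane) :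
    tau (τ.im / (2 * Real.pi)) (2 * Real.pi * τ.re) = (τ : ℂ) := by
  have hπ := Real.pi_ne_zero
  apply Complex.ext
  · rw [re_tau, mul_div_cancel_left₀ _ (by positivity)]; rfl
  · rw [im_tau, mul_div_cancel₀ _ (by positivity)]; rfl

theorem Zbar_S (τ : UpperHalfPlane) : Zbar N (ModularGroup.S • τ) = Zbar N τ := by
  set β := τ.im / (2 * Real.pi) with hβ
  set θ := 2 * Real.pi * τ.re with hθ
  have hβ0 : 0 < β := div_pos τ.im_pos Real.two_pi_pos
  have h1 : tau ((ModularGroup.S • τ).im / (2 * Real.pi)) (2 * Real.pi * (ModularGroup.S • τ).re)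
      = tau (dualBeta β θ) (dualTheta β θ) := by
    rw [tau_coe, UpperHalfPlane.modular_S_smul, ← neg_one_div_tau, hβ, hθ, tau_coe,
      UpperHalfPlane.coe_mk, neg_div, one_div, inv_neg]
  obtain ⟨h2, h3⟩ := tau_ext h1
  rw [Zbar, Zbar, h2, h3, ← hβ, ← hθ, Z_S_dual hβ0 θ, ← mul_assoc]
  congr 1
  rw [← Complex.ofReal_mul, ← mul_pow, ← Real.sqrt_mul hβ0.le, mul_div_cancel₀ _ hβ0.ne']

theorem Zbar_T (τ : UpperHalfPlane) : Zbar N (ModularGroup.T • τ) = Zbar N τ := by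
  rw [UpperHalfPlane.modular_T_smul, Zbar, Zbar, UpperHalfPlane.vadd_im, UpperHalfPlane.vadd_re,
    mul_add, mul_one, add_comm (2 * Real.pi), Z_T_dual (div_pos τ.im_pos Real.two_pi_pos)]

theorem Zbar_modular (γ : Matrix.SpecialLinearGroup (Fin 2) ℤ) (τ : UpperHalfPlane) :
    Zbar N (γ • τ) = Zbar N τ := by
  have hγ : γ ∈ Subgroup.closure {ModularGroup.S, ModularGroup.T} := by
    simp [SpecialLinearGroup.SL2Z_generators]
  induction hγ using Subgroup.closure_induction generalizing τ with
  | one => rw [one_smul]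
  | mem g hg =>
    rcases hg with rfl | rfl
    · exact Zbar_S τ
    · exact Zbar_T τ
  | mul g h _ _ ig ih => rw [mul_smul, ig, ih]
  | inv g _ ig => rw [← ig, smul_inv_smul]

theorem exists_Z_theta (N : ℕ) [NeZero N] :
    ∃ C : ℝ, 0 < C ∧ ∀ β θ : ℝ, 0 < β →
      Z N β θ = ((C / Real.sqrt β ^ (3 * (N ^ 4 - 1)) *
          (‖thetaChar 0 0 0 (2 * tau β θ)‖ ^ 2 +
            ‖thetaChar (1 / 2) 0 0 (2 * tau β θ)‖ ^ 2) ^ 3 : ℝ) : ℂ) := by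
  obtain ⟨c, hc, h⟩ := exists_Z_eq N
  refine ⟨c, hc, fun β θ hβ => ?_⟩
  rw [h β θ hβ, tsum_pairWeight hβ, thetaSum, Complex.ofReal_mul, Complex.ofReal_pow]

end Modular

end

end VillainMaxwell

theorem mainTheorem2 (N : ℕ) [NeZero N] :
    -- the partition function is well defined
    (∀ β θ : ℝ, 0 < β →
      VillainMaxwell.PathConvergent (VillainMaxwell.boxMeasure (VillainMaxwell.Link N))
        (VillainMaxwell.weight β θ)) ∧
    -- the theta-function formula, with a constant that depends on `N` only
    (∃ C : ℝ, 0 < C ∧ ∀ β θ : ℝ, 0 < β →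
      VillainMaxwell.Z N β θ =
        ((C / Real.sqrt β ^ (3 * (N ^ 4 - 1)) *
          (‖VillainMaxwell.thetaChar 0 0 0 (2 * VillainMaxwell.tau β θ)‖ ^ 2 +
            ‖VillainMaxwell.thetaChar (1 / 2) 0 0 (2 * VillainMaxwell.tau β θ)‖ ^ 2) ^ 3 : ℝ) :
          ℂ)) ∧
    -- S-duality
    (∀ β θ : ℝ, 0 < β →
      0 < VillainMaxwell.dualBeta β θ ∧
      -1 / VillainMaxwell.tau β θ =
        VillainMaxwell.tau (VillainMaxwell.dualBeta β θ) (VillainMaxwell.dualTheta β θ) ∧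
      VillainMaxwell.Z N β θ =
        ((Real.sqrt (VillainMaxwell.dualBeta β θ / β) ^ (3 * N ^ 4) : ℝ) : ℂ) *
          VillainMaxwell.Z N (VillainMaxwell.dualBeta β θ) (VillainMaxwell.dualTheta β θ)) ∧
    -- T-duality
    (∀ β θ : ℝ, 0 < β →
      VillainMaxwell.Z N β (θ + 2 * Real.pi) = VillainMaxwell.Z N β θ) ∧
    -- modular invariance of the rescaled partition function
    (∀ (γ : Matrix.SpecialLinearGroup (Fin 2) ℤ) (τ : UpperHalfPlane),
      VillainMaxwell.Zbar N (γ • τ) = VillainMaxwell.Zbar N τ) ∧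
    -- without monopoles the non-local charges agree with the ultra-local one
    (∀ (A : VillainMaxwell.Link N → ℝ) (n : VillainMaxwell.Plaq N → ℤ),
      VillainMaxwell.d2 n = 0 →
      VillainMaxwell.QNL (VillainMaxwell.fieldE A n) =
          VillainMaxwell.Q0 (VillainMaxwell.fieldE A n) ∧
      VillainMaxwell.QNLdual (VillainMaxwell.fieldE A n) =
          VillainMaxwell.Q0 (VillainMaxwell.fieldE A n)) ∧
    -- the duality before integration: original, Poisson-dual and dual-lattice path integrals
    (∀ β θ : ℝ, 0 < β →
      (VillainMaxwell.PathConvergent (VillainMaxwell.boxMeasureEM N)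
          (VillainMaxwell.weightE VillainMaxwell.QNL β θ) ∧
        VillainMaxwell.Z N β θ =
          VillainMaxwell.pathIntegral (VillainMaxwell.boxMeasureEM N)
            (VillainMaxwell.weightE VillainMaxwell.QNL β θ)) ∧
      (VillainMaxwell.PathConvergent (VillainMaxwell.boxMeasureEM N)
          (VillainMaxwell.weightM VillainMaxwell.QNL
            (VillainMaxwell.dualBeta β θ) (VillainMaxwell.dualTheta β θ)) ∧
        VillainMaxwell.Z N β θ =
          ((Real.sqrt (VillainMaxwell.dualBeta β θ / β) ^ (3 * N ^ 4) : ℝ) : ℂ) *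
            VillainMaxwell.pathIntegral (VillainMaxwell.boxMeasureEM N)
              (VillainMaxwell.weightM VillainMaxwell.QNL
                (VillainMaxwell.dualBeta β θ) (VillainMaxwell.dualTheta β θ))) ∧
      (VillainMaxwell.PathConvergent (VillainMaxwell.boxMeasureEM N)
          (VillainMaxwell.weightE VillainMaxwell.QNLdual
            (VillainMaxwell.dualBeta β θ) (VillainMaxwell.dualTheta β θ)) ∧
        VillainMaxwell.Z N β θ =
          ((Real.sqrt (VillainMaxwell.dualBeta β θ / β) ^ (3 * N ^ 4) : ℝ) : ℂ) *
            VillainMaxwell.pathIntegral (VillainMaxwell.boxMeasureEM N)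
              (VillainMaxwell.weightE VillainMaxwell.QNLdual
                (VillainMaxwell.dualBeta β θ) (VillainMaxwell.dualTheta β θ)))) := by
  have hcl (A : VillainMaxwell.Link N → ℝ) (n : VillainMaxwell.Plaq N → ℤ)
      (hn : VillainMaxwell.d2 n = 0) : VillainMaxwell.d2 (VillainMaxwell.fieldE A n) = 0 := by
    rw [VillainMaxwell.d2_fieldE, hn]
    funext c
    simp
  refine ⟨fun β θ hβ => (VillainMaxwell.weight_hasSum hβ θ).1, VillainMaxwell.exists_Z_theta N,
    fun β θ hβ => ⟨VillainMaxwell.dualBeta_pos hβ θ, VillainMaxwell.neg_one_div_tau β θ,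
      VillainMaxwell.Z_S_dual hβ θ⟩,
    fun β θ hβ => VillainMaxwell.Z_T_dual hβ θ, VillainMaxwell.Zbar_modular,
    fun A n hn => ⟨VillainMaxwell.QNL_of_closed (hcl A n hn),
      VillainMaxwell.QNLdual_of_closed (hcl A n hn)⟩, fun β θ hβ => ?_⟩
  have hd := VillainMaxwell.dualBeta_pos hβ θ
  obtain ⟨h1, h1'⟩ := VillainMaxwell.pathIntegral_weightE (N := N) (Q := VillainMaxwell.QNL)
    (VillainMaxwell.continuous_chargeNL _) (fun _ => VillainMaxwell.QNL_of_closed) hβ θ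
  obtain ⟨h2, h2'⟩ := VillainMaxwell.pathIntegral_weightM (N := N) hd
    (VillainMaxwell.dualTheta β θ)
  obtain ⟨h3, h3'⟩ := VillainMaxwell.pathIntegral_weightE (N := N)
    (Q := VillainMaxwell.QNLdual) (VillainMaxwell.continuous_chargeNL _)
    (fun _ => VillainMaxwell.QNLdual_of_closed) hd (VillainMaxwell.dualTheta β θ)
  -- The last two integrals equal `Z` at the dual couplings; S-duality returns them to the original
  -- ones.
  have hZ := VillainMaxwell.Z_S_dual (N := N) hβ θ
  exact ⟨⟨h1, h1'.symm⟩, ⟨h2, by rw [h2', hZ]⟩, ⟨h3, by rw [h3', hZ]⟩⟩
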